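/- Let $(M,J,g)$ be a smooth almost Norden manifold of dimension $2n$: $g$ is a smooth pseudo-Riemannian metric and $J$ a smooth almost complex structure with $g(JX,JY)=-g(X,Y)$ (so $g$ has signature $(n,n)$). Let $\nabla$ be the Levi-Civita connection of $g$, $R(X,Y)Z=\nabla_X\nabla_YZ-\nabla_Y\nabla_XZ-\nabla_{[X,Y]}Z$ and $R(x,y,z,w)=g(R(x,y)z,w)$. Put $F(x,y,z)=g((\nabla_xJ)y,z)$ and let $$\theta(z)=g^{ij}F(e_i,e_j,z),\qquad \rho(y,z)=g^{ij}R(e_i,y,z,e_j),\qquad \rho^*(y,z)=g^{ij}R(e_i,y,z,Je_j)$$ be the Lee form, the Ricci tensor and the associated Ricci tensor of $M$, where $(e_i)$ is any basis of the tangent space, $g_{ij}=g(e_i,e_j)$ and $(g^{ij})=(g_{ij})^{-1}$. For a vector field $X$ on $M$ let $X^V$ and $X^H$ be its vertical lift and its horizontal lift with respect to $\nabla$ to the tangent bundle $TM$. Let $\hat g$ be the complete lift of $g$ to $TM$, that is, $$\hat g(X^H,Y^H)=\hat g(X^V,Y^V)=0,\qquad \hat g(X^H,Y^V)=\hat g(X^V,Y^H)=g(X,Y),$$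 and let $J_1,J_2,J_3$ be the almost complex structures on $TM$ given by $$J_1X^H=-(JX)^H,\quad J_1X^V=(JX)^V;\qquad J_2X^H=X^V,\quad J_2X^V=-X^H;\qquad J_3X^H=(JX)^V,\quad J_3X^V=(JX)^H.$$ Let $\hat\nabla$ be the Levi-Civita connection of $\hat g$, $F_\alpha(\xi,\eta,\zeta)=\hat g((\hat\nabla_\xi J_\alpha)\eta,\zeta)$, and let $\theta_\alpha(\zeta)=\hat g^{AB}F_\alpha(\hat e_A,\hat e_B,\zeta)$ be the corresponding Lee forms, where $(\hat e_A)$ is any basis of the tangent space of $TM$ at the given point and $(\hat g^{AB})$ is the inverse of the matrix $(\hat g(\hat e_A,\hat e_B))$ ($\alpha=1,2,3$). Then: (i) $\theta_1=0$ on $TM$ if and only if $\theta=0$ on $M$; (ii) $\theta_2=0$ on $TM$ if and only if $\rho=0$ on $M$; (iii) $\theta_3=0$ on $TM$ if and only if $\theta=0$ and $\rho^*=0$ on $M$. -/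

import Mathlib

set_option maxSynthPendingDepth 3

open Bundle Manifold ContDiff

noncomputable section

namespace AlmostNorden

section Pointwise

variable {V W : Type*} [AddCommGroup V] [Module ℝ V] [TopologicalSpace V]
  [AddCommGroup W] [Module ℝ W] [TopologicalSpace W]

/-- The bilinear form `(v, w) ↦ B (a v) (b w)`. -/
def pullForm (B : W →L[ℝ] W →L[ℝ] ℝ) (a b : V →L[ℝ] W) : V →L[ℝ] V →L[ℝ] ℝ :=
  (ContinuousLinearMap.precomp ℝ b).comp (B.comp a)

@[simp]
theorem pullForm_apply (B : W →L[ℝ] W →L[ℝ] ℝ) (a b : V →L[ℝ] W) (v w : V) :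
    pullForm B a b v w = B (a v) (b w) := rfl

/-- The trace `g^{ij} B(e_i, e_j)` of `B` with respect to the form `g`, where `(e_i)` is a basis and
`(g^{ij})` is the inverse of the matrix `(g(e_i, e_j))`. For a nondegenerate form `g` and a
bilinear `B` it does not depend on the basis. -/
def metricTrace [FiniteDimensional ℝ V] (g : V →L[ℝ] V →L[ℝ] ℝ) (B : V → V → ℝ) : ℝ :=
  letI e := Module.finBasis ℝ V
  ∑ i, ∑ j, (Matrix.of fun k l ↦ g (e k) (e l))⁻¹ i j * B (e i) (e j)

end Pointwise

section Manifold

variable {E : Type*} [NormedAddCommGroup E] [NormedSpace ℝ E]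
  {H : Type*} [TopologicalSpace H] {I : ModelWithCorners ℝ E H}
  {M : Type*} [TopologicalSpace M] [ChartedSpace H M]

variable (I M) in
/-- Fields of bilinear forms on the tangent spaces, that is, `(0,2)`-tensor fields. -/
abbrev FormField := Π p : M, TangentSpace I p →L[ℝ] TangentSpace I p →L[ℝ] ℝ

variable (I M) in
/-- Fields of endomorphisms of the tangent spaces, that is, `(1,1)`-tensor fields. -/
abbrev EndField := Π p : M, TangentSpace I p →L[ℝ] TangentSpace I p

variable [IsManifold I 1 M]

/-! ### The Levi-Civita connection -/

/-- The frame of coordinate vector fields of the preferred chart at `p`: `frame p q a` is the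
vector at `q` with the constant components `a` in that chart. -/
def frame (p q : M) : E →L[ℝ] TangentSpace I q :=
  (trivializationAt E (TangentSpace I : M → Type _) p).symmL ℝ q

/-- The components in the preferred chart at `p` of a vector at `q`. -/
def components (p q : M) : TangentSpace I q →L[ℝ] E :=
  (trivializationAt E (TangentSpace I : M → Type _) p).continuousLinearMapAt ℝ q

/-- The components `g_{ij}`, in the preferred chart at `p`, of a field `g` of bilinear forms. -/
def metricComponents (g : FormField I M)
    (p q : M) : E →L[ℝ] E →L[ℝ] ℝ :=
  pullForm (g q) (frame p q) (frame p q)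

/-- The derivatives `∂_k g_{ij}` at `p`, in the preferred chart at `p`; the first argument is the
direction of differentiation. -/
def metricDerivative (g : FormField I M)
    (p : M) : E →L[ℝ] E →L[ℝ] E →L[ℝ] ℝ :=
  (mvfderiv I (metricComponents g p) p).comp (frame p p)

/-- The Christoffel symbols of the first kind
`(a, b, c) ↦ (∂_a g(b, c) + ∂_b g(a, c) - ∂_c g(a, b)) / 2` at `p`, in the preferred chart
at `p`. -/
def christoffelFirst (g : FormField I M)
    (p : M) (a : E) : E →L[ℝ] E →L[ℝ] ℝ :=
  (2⁻¹ : ℝ) • (metricDerivative g p a + (metricDerivative g p).flip a -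
    ((metricDerivative g p).flip a).flip)

theorem christoffelFirst_apply (g : FormField I M)
    (p : M) (a b c : E) :
    christoffelFirst g p a b c =
      2⁻¹ * (metricDerivative g p a b c + metricDerivative g p b a c
        - metricDerivative g p c a b) := by
  simp [christoffelFirst]

/-- The Christoffel symbols (of the second kind) at `p`, in the preferred chart at `p`. -/
def christoffel (g : FormField I M)
    (p : M) (a : E) : E →L[ℝ] E :=
  (metricComponents g p p).inverse.comp (christoffelFirst g p a)

theorem christoffel_add (g : FormField I M)
    (p : M) (a b : E) : christoffel g p (a + b) = christoffel g p a + christoffel g p b := by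
  ext c
  simp only [christoffel, ContinuousLinearMap.comp_apply, _root_.add_apply,
    ← map_add]
  congr 1
  ext d
  simp only [christoffelFirst_apply, _root_.add_apply, map_add]
  ring

theorem christoffel_smul (g : FormField I M)
    (p : M) (r : ℝ) (a : E) : christoffel g p (r • a) = r • christoffel g p a := by
  ext c
  simp only [christoffel, ContinuousLinearMap.comp_apply, _root_.smul_apply,
    ← map_smul]
  congr 1
  ext d
  simp only [christoffelFirst_apply, _root_.smul_apply, map_smul, smul_eq_mul]
  ring

theorem eventually_components (p : M) (σ : Π q : M, TangentSpace I q) :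
    (fun q ↦ (trivializationAt E (TangentSpace I : M → Type _) p ⟨q, σ q⟩).2) =ᶠ[nhds p]
      fun q ↦ components p q (σ q) := by
  filter_upwards [(trivializationAt E (TangentSpace I : M → Type _) p).open_baseSet.mem_nhds
    (FiberBundle.mem_baseSet_trivializationAt' p)] with q hq
  exact (Trivialization.continuousLinearMapAt_apply_of_mem ℝ _ hq _).symm

theorem mdifferentiableAt_components {p : M} {σ : Π q : M, TangentSpace I q}
    (hσ : MDifferentiableAt I (I.prod 𝓘(ℝ, E)) (fun q ↦ TotalSpace.mk' E q (σ q)) p) :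
    MDifferentiableAt I 𝓘(ℝ, E) (fun q ↦ components p q (σ q)) p :=
  ((mdifferentiableAt_section I σ).1 hσ).congr_of_eventuallyEq (eventually_components p σ).symm

theorem frame_components (p : M) (x : TangentSpace I p) : frame p p (components p p x) = x :=
  Trivialization.symmL_continuousLinearMapAt _ (FiberBundle.mem_baseSet_trivializationAt' p) x

theorem components_frame (p : M) (a : E) : components (I := I) p p (frame p p a) = a :=
  Trivialization.continuousLinearMapAt_symmL _ (FiberBundle.mem_baseSet_trivializationAt' p) a

/-- The Levi-Civita connection of a pseudo-Riemannian metric `g`. In the preferred chart at `p`,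
`(∇_x σ)^k = x^i ∂_i σ^k + Γ^k_{ij} x^i σ^j`. As in Mathlib, `leviCivita g σ p x` is `∇_x σ`
at the point `p`. -/
def leviCivita (g : FormField I M) :
    CovariantDerivative I E (TangentSpace I : M → Type _) where
  toFun σ p := (frame p p).comp
    (mvfderiv I (fun q ↦ components p q (σ q)) p +
      (christoffel g p (components p p (σ p))).comp (components p p))
  isCovariantDerivativeOnUniv :=
    { add := by
        intro σ σ' p hσ hσ' _
        ext x
        have h := mvfderiv_fun_add (mdifferentiableAt_components hσ)
          (mdifferentiableAt_components hσ')
        simp only [Pi.add_apply, map_add, h, christoffel_add, ContinuousLinearMap.comp_apply,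
          _root_.add_apply]
        abel
      leibniz := by
        intro σ f p hσ hf _
        ext x
        have h := mvfderiv_fun_smul hf (mdifferentiableAt_components hσ)
        simp only [Pi.smul_apply', map_smul, h, christoffel_smul, ContinuousLinearMap.comp_apply,
          _root_.add_apply, _root_.smul_apply, map_add,
          ContinuousLinearMap.smulRight_apply, frame_components]
        module }

/-- The covariant derivative `(∇_x A) y = ∇_x (A Y) - A (∇_x Y)` at `p` of a field `A` of
endomorphisms, where `Y` is a vector field that is smooth near `p` and has the value `y` at `p`. -/
def covDerivEnd (cov : CovariantDerivative I E (TangentSpace I : M → Type _))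
    (A : EndField I M) (p : M) (x y : TangentSpace I p) : TangentSpace I p :=
  letI Y : Π q : M, TangentSpace I q := FiberBundle.extend E y
  cov (fun q ↦ A q (Y q)) p x - A p (cov Y p x)

/-- The curvature `R(x, y) z = ∇_x ∇_y Z - ∇_y ∇_x Z - ∇_{[X, Y]} Z` at `p`, where `X`, `Y`, `Z`
are vector fields that are smooth near `p` and have the values `x`, `y`, `z` at `p`. -/
def curvature (cov : CovariantDerivative I E (TangentSpace I : M → Type _))
    (p : M) (x y z : TangentSpace I p) : TangentSpace I p :=
  letI X : Π q : M, TangentSpace I q := FiberBundle.extend E x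
  letI Y : Π q : M, TangentSpace I q := FiberBundle.extend E y
  letI Z : Π q : M, TangentSpace I q := FiberBundle.extend E z
  cov (fun q ↦ cov Z q (Y q)) p x - cov (fun q ↦ cov Z q (X q)) p y
    - cov Z p (VectorField.mlieBracket I X Y p)

variable [FiniteDimensional ℝ E]

instance instFiniteDimensionalTangentSpace (p : M) : FiniteDimensional ℝ (TangentSpace I p) :=
  inferInstanceAs (FiniteDimensional ℝ E)

instance instT2SpaceTangentSpace (p : M) : T2Space (TangentSpace I p) :=
  inferInstanceAs (T2Space E)

/-! ### Tensors of a metric and a field of endomorphisms -/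

/-- The structure tensor `F(x, y, z) = g((∇_x A) y, z)`, with `∇` the Levi-Civita connection
of `g`. -/
def structureTensor (g : FormField I M) (A : EndField I M) (p : M)
    (x y z : TangentSpace I p) : ℝ :=
  g p (covDerivEnd (leviCivita g) A p x y) z

/-- The Lee form `θ(z) = g^{ij} F(e_i, e_j, z)`. -/
def leeForm (g : FormField I M) (A : EndField I M) (p : M) (z : TangentSpace I p) : ℝ :=
  metricTrace (g p) fun x y ↦ structureTensor g A p x y z

/-- The curvature tensor `R(x, y, z, w) = g(R(x, y) z, w)` of type `(0,4)` of the Levi-Civita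
connection. -/
def curvatureTensor (g : FormField I M) (p : M) (x y z w : TangentSpace I p) : ℝ :=
  g p (curvature (leviCivita g) p x y z) w

/-- The Ricci tensor `ρ(y, z) = g^{ij} R(e_i, y, z, e_j)`. -/
def ricci (g : FormField I M) (p : M) (y z : TangentSpace I p) : ℝ :=
  metricTrace (g p) fun x w ↦ curvatureTensor g p x y z w

/-- The associated Ricci tensor `ρ*(y, z) = g^{ij} R*(e_i, y, z, e_j)`, where
`R*(x, y, z, w) = R(x, y, z, A w)`. -/
def associatedRicci (g : FormField I M) (A : EndField I M) (p : M)
    (y z : TangentSpace I p) : ℝ :=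
  metricTrace (g p) fun x w ↦ curvatureTensor g p x y z (A p w)

end Manifold

section TangentBundle

variable {E : Type*} [NormedAddCommGroup E] [NormedSpace ℝ E]
  {H : Type*} [TopologicalSpace H] {I : ModelWithCorners ℝ E H}
  {M : Type*} [TopologicalSpace M] [ChartedSpace H M] [IsManifold I ∞ M]

/-! ### Almost Norden manifolds -/

variable (I M) in
/-- An almost Norden structure: a smooth pseudo-Riemannian metric `g` and a smooth almost complex
structure `J` that acts as an anti-isometry. That `g` is neutral and that the dimension is even
follows from this. -/
structure AlmostNordenStructure where
  /-- The metric. -/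
  g : FormField I M
  /-- The almost complex structure. -/
  J : EndField I M
  g_symm : ∀ p x y, g p x y = g p y x
  g_nondegenerate : ∀ p x, (∀ y, g p x y = 0) → x = 0
  g_smooth : ContMDiff I (I.prod 𝓘(ℝ, E →L[ℝ] E →L[ℝ] ℝ)) ∞
    fun p ↦ TotalSpace.mk' (E →L[ℝ] E →L[ℝ] ℝ)
      (E := fun p : M ↦ TangentSpace I p →L[ℝ] TangentSpace I p →L[ℝ] ℝ) p (g p)
  J_smooth : ContMDiff I (I.prod 𝓘(ℝ, E →L[ℝ] E)) ∞
    fun p ↦ TotalSpace.mk' (E →L[ℝ] E)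
      (E := fun p : M ↦ TangentSpace I p →L[ℝ] TangentSpace I p) p (J p)
  J_sq : ∀ p x, J p (J p x) = -x
  g_J : ∀ p x y, g p (J p x) (J p y) = -g p x y

/-! ### Lifts to the tangent bundle

The preferred chart of the tangent bundle at `u` is the one induced by the preferred chart `(x^i)`
of the base at the base point of `u`, with coordinates `(x^i, v^i)` for the vector `v^i ∂/∂x^i`. -/

/-- The vertical lift `x ↦ x^V` at `u`. In the induced chart, `x^V = x^k ∂/∂v^k`. -/
def verticalLift (u : TangentBundle I M) :
    TangentSpace I u.proj →L[ℝ] TangentSpace I.tangent u :=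
  (frame u u).comp ((ContinuousLinearMap.inr ℝ E E).comp (components u.proj u.proj))

/-- The horizontal lift `x ↦ x^H` at `u` with respect to a connection. In the induced chart,
`x^H = x^i ∂/∂x^i - Γ^k_{ij} x^i u^j ∂/∂v^k`. Here `Γ^k_{ij} x^i u^j` are the components of
`∇_x U`, where the vector field `U` has the constant components `u^j`. -/
def horizontalLift (cov : CovariantDerivative I E (TangentSpace I : M → Type _))
    (u : TangentBundle I M) : TangentSpace I u.proj →L[ℝ] TangentSpace I.tangent u :=
  letI U : Π q : M, TangentSpace I q := FiberBundle.extend E u.snd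
  (frame u u).comp
    ((components u.proj u.proj).prod (-((components u.proj u.proj).comp (cov U u.proj))))

variable [FiniteDimensional ℝ E]

theorem splitting_bijective (cov : CovariantDerivative I E (TangentSpace I : M → Type _))
    (u : TangentBundle I M) :
    Function.Bijective ((horizontalLift cov u).coprod (verticalLift u)) := by
  have hinj : Function.Injective ((horizontalLift cov u).coprod (verticalLift u)) := by
    rw [injective_iff_map_eq_zero]
    rintro ⟨x, y⟩ h
    have h' := congrArg (components u u) h
    simp only [ContinuousLinearMap.coprod_apply, horizontalLift, verticalLift,
      ContinuousLinearMap.comp_apply, map_add, components_frame, map_zero,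
      ContinuousLinearMap.prod_apply, ContinuousLinearMap.inr_apply, Prod.mk_add_mk, add_zero,
      Prod.mk_eq_zero] at h'
    have hx : x = 0 := by rw [← frame_components u.proj x, h'.1, map_zero]
    subst hx
    have hy := h'.2
    rw [map_zero, zero_add] at hy
    rw [← frame_components u.proj y, hy, map_zero]
    rfl
  refine ⟨hinj, ?_⟩
  have hd : Module.finrank ℝ (TangentSpace I u.proj × TangentSpace I u.proj) =
      Module.finrank ℝ (TangentSpace I.tangent u) :=
    show Module.finrank ℝ (E × E) = Module.finrank ℝ (E × E) from rfl
  exact (LinearMap.injective_iff_surjective_of_finrank_eq_finrank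
    (f := ((horizontalLift cov u).coprod (verticalLift u)).toLinearMap) hd).1 hinj

/-- The splitting `(x, y) ↦ x^H + y^V` of the tangent space at `u` of the tangent bundle into
horizontal and vertical vectors. -/
def splitting (cov : CovariantDerivative I E (TangentSpace I : M → Type _))
    (u : TangentBundle I M) :
    (TangentSpace I u.proj × TangentSpace I u.proj) ≃L[ℝ] TangentSpace I.tangent u :=
  (LinearEquiv.ofBijective _ (splitting_bijective cov u)).toContinuousLinearEquiv

/-- The base vector `x` in the decomposition `x^H + y^V` of a vector at `u`. -/
def horizontalPart (cov : CovariantDerivative I E (TangentSpace I : M → Type _))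
    (u : TangentBundle I M) : TangentSpace I.tangent u →L[ℝ] TangentSpace I u.proj :=
  (ContinuousLinearMap.fst ℝ _ _).comp (splitting cov u).symm.toContinuousLinearMap

/-- The base vector `y` in the decomposition `x^H + y^V` of a vector at `u`. -/
def verticalPart (cov : CovariantDerivative I E (TangentSpace I : M → Type _))
    (u : TangentBundle I M) : TangentSpace I.tangent u →L[ℝ] TangentSpace I u.proj :=
  (ContinuousLinearMap.snd ℝ _ _).comp (splitting cov u).symm.toContinuousLinearMap

theorem splitting_apply (cov : CovariantDerivative I E (TangentSpace I : M → Type _))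
    (u : TangentBundle I M) (x y : TangentSpace I u.proj) :
    splitting cov u (x, y) = horizontalLift cov u x + verticalLift u y := rfl

theorem splitting_symm_horizontalLift
    (cov : CovariantDerivative I E (TangentSpace I : M → Type _))
    (u : TangentBundle I M) (x : TangentSpace I u.proj) :
    (splitting cov u).symm (horizontalLift cov u x) = (x, 0) := by
  rw [ContinuousLinearEquiv.symm_apply_eq, splitting_apply, map_zero, add_zero]

theorem splitting_symm_verticalLift
    (cov : CovariantDerivative I E (TangentSpace I : M → Type _))
    (u : TangentBundle I M) (y : TangentSpace I u.proj) :
    (splitting cov u).symm (verticalLift u y) = (0, y) := by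
  rw [ContinuousLinearEquiv.symm_apply_eq, splitting_apply, map_zero, zero_add]

/-- The complete lift `ĝ` of a metric `g`, with `ĝ(x^H, y^H) = ĝ(x^V, y^V) = 0` and
`ĝ(x^H, y^V) = ĝ(x^V, y^H) = g(x, y)`. -/
def completeLift (g : FormField I M) : FormField I.tangent (TangentBundle I M) := fun u ↦
  letI h := horizontalPart (leviCivita g) u
  letI v := verticalPart (leviCivita g) u
  pullForm (g u.proj) h v + pullForm (g u.proj) v h

/-- `J₁ x^H = -(J x)^H` and `J₁ x^V = (J x)^V`. -/
def liftJ₁ (g : FormField I M) (J : EndField I M) : EndField I.tangent (TangentBundle I M) :=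
  fun u ↦
    -(horizontalLift (leviCivita g) u).comp ((J u.proj).comp (horizontalPart (leviCivita g) u)) +
      (verticalLift u).comp ((J u.proj).comp (verticalPart (leviCivita g) u))

/-- `J₂ x^H = x^V` and `J₂ x^V = -x^H`. -/
def liftJ₂ (g : FormField I M) : EndField I.tangent (TangentBundle I M) :=
  fun u ↦
    (verticalLift u).comp (horizontalPart (leviCivita g) u) -
      (horizontalLift (leviCivita g) u).comp (verticalPart (leviCivita g) u)

/-- `J₃ x^H = (J x)^V` and `J₃ x^V = (J x)^H`. -/
def liftJ₃ (g : FormField I M) (J : EndField I M) : EndField I.tangent (TangentBundle I M) :=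
  fun u ↦
    (verticalLift u).comp ((J u.proj).comp (horizontalPart (leviCivita g) u)) +
      (horizontalLift (leviCivita g) u).comp ((J u.proj).comp (verticalPart (leviCivita g) u))

end TangentBundle

end AlmostNorden

end

/-!
A vector tangent to `TM` is a sum `x^H + y^V`, and in this splitting the complete lift pairs
horizontal with vertical vectors. Hence the Lee form of an endomorphism field `𝒜` of `TM` is a sum
of two `g`-traces over `M`, of `(∇̂_{x^H} 𝒜) y^V` and of `(∇̂_{x^V} 𝒜) y^H`.

In the coordinates `(x, v)` induced by a chart of `M`, the Christoffel symbols of `ĝ` show that at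
`u`, for vector fields `X` and `Y` on `M`, `∇̂_{X^H} Y^V = (∇_X Y)^V`,
`∇̂_{X^H} Y^H = (∇_X Y)^H + (R(u, X) Y)^V` and `∇̂_{X^V} Y^H = ∇̂_{X^V} Y^V = 0`. So if `𝒜` has the
blocks `x^H ↦ (P x)^H + (Q x)^V` and `x^V ↦ (R x)^H + (T x)^V`, the second trace vanishes and
`(∇̂_{x^H} 𝒜) y^V = ((∇_x R) y)^H + ((∇_x T) y + R(u, x) R y)^V`: the Lee form of `𝒜` at
`x^H + y^V` is `θ_R(y) + θ_T(x) + ρ*_R(u, x)`. For `J₁`, `J₂`, `J₃` the pair of blocks `(R, T)` is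
`(0, J)`, `(-id, 0)`, `(J, 0)`, which gives `θ(x)`, `-ρ(u, x)` and `θ(y) + ρ*(u, x)`.
-/

noncomputable section

namespace AlmostNorden

section Derivatives

variable {F V W X : Type*} [NormedAddCommGroup F] [NormedSpace ℝ F]
  [NormedAddCommGroup V] [NormedSpace ℝ V] [NormedAddCommGroup W] [NormedSpace ℝ W]
  [NormedAddCommGroup X] [NormedSpace ℝ X]

theorem fderiv_apply_const {f : F → V →L[ℝ] W} {y : F} (hf : DifferentiableAt ℝ f y) (v : V)
    (a : F) : fderiv ℝ (fun z ↦ f z v) y a = fderiv ℝ f y a v := by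
  simp [fderiv_clm_apply hf (differentiableAt_const v)]

theorem fderiv_apply_const₂ {f : F → V →L[ℝ] W →L[ℝ] X} {y : F} (hf : DifferentiableAt ℝ f y)
    (v : V) (w : W) (a : F) : fderiv ℝ (fun z ↦ f z v w) y a = fderiv ℝ f y a v w := by
  rw [fderiv_apply_const (hf.clm_apply (differentiableAt_const v)), fderiv_apply_const hf]

theorem differentiableAt_comp_fst {f : F → W} {w : F × V} (hf : DifferentiableAt ℝ f w.1) :
    DifferentiableAt ℝ (fun z : F × V ↦ f z.1) w :=
  hf.comp w differentiableAt_fst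

theorem fderiv_comp_fst {f : F → W} {w : F × V} (hf : DifferentiableAt ℝ f w.1) (a : F × V) :
    fderiv ℝ (fun z : F × V ↦ f z.1) w a = fderiv ℝ f w.1 a.1 := by
  rw [fderiv_fun_comp w hf differentiableAt_fst, fderiv_fst]
  rfl

theorem differentiableAt_apply_fst_snd {f : F → V →L[ℝ] W} {w : F × V}
    (hf : DifferentiableAt ℝ f w.1) : DifferentiableAt ℝ (fun z : F × V ↦ f z.1 z.2) w :=
  (differentiableAt_comp_fst hf).clm_apply differentiableAt_snd

theorem fderiv_apply_fst_snd {f : F → V →L[ℝ] W} {w : F × V} (hf : DifferentiableAt ℝ f w.1)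
    (a : F × V) :
    fderiv ℝ (fun z : F × V ↦ f z.1 z.2) w a = fderiv ℝ f w.1 a.1 w.2 + f w.1 a.2 := by
  rw [fderiv_clm_apply (differentiableAt_comp_fst hf) differentiableAt_snd, fderiv_snd]
  simp [fderiv_comp_fst hf, add_comm]

end Derivatives

section Coordinates

variable {F : Type*} [NormedAddCommGroup F] [NormedSpace ℝ F]

/-! ### The Levi-Civita connection of a metric on a vector space -/

/-- The map `D ↦ ((a, b, c) ↦ (D a b c + D b a c - D c a b) / 2)`, which turns the derivative of a
metric into its Christoffel symbols of the first kind. -/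
def koszulMap : (F →L[ℝ] F →L[ℝ] F →L[ℝ] ℝ) →L[ℝ] (F →L[ℝ] F →L[ℝ] F →L[ℝ] ℝ) :=
  letI flip : (F →L[ℝ] F →L[ℝ] F →L[ℝ] ℝ) →L[ℝ] (F →L[ℝ] F →L[ℝ] F →L[ℝ] ℝ) :=
    (ContinuousLinearMap.flipₗᵢ ℝ F F (F →L[ℝ] ℝ)).toContinuousLinearEquiv.toContinuousLinearMap
  letI flip₂ : (F →L[ℝ] F →L[ℝ] ℝ) →L[ℝ] (F →L[ℝ] F →L[ℝ] ℝ) :=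
    (ContinuousLinearMap.flipₗᵢ ℝ F F ℝ).toContinuousLinearEquiv.toContinuousLinearMap
  (2⁻¹ : ℝ) • (.id ℝ _ + flip - (ContinuousLinearMap.postcomp F flip₂).comp flip)

theorem koszulMap_apply (D : F →L[ℝ] F →L[ℝ] F →L[ℝ] ℝ) (a b c : F) :
    koszulMap D a b c = 2⁻¹ * (D a b c + D b a c - D c a b) :=
  rfl

/-- The Christoffel symbols of a field `G` of bilinear forms on a vector space. The first argument
is the vector being differentiated, the second one the direction. -/
def chartChristoffel (G : F → F →L[ℝ] F →L[ℝ] ℝ) (y : F) : F →L[ℝ] F →L[ℝ] F :=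
  (ContinuousLinearMap.compL ℝ F (F →L[ℝ] ℝ) F (G y).inverse).comp (koszulMap (fderiv ℝ G y))

/-- The covariant derivative `∇_a s` at `y` of the vector field `s` on a vector space. -/
def chartNabla (G : F → F →L[ℝ] F →L[ℝ] ℝ) (s : F → F) (y a : F) : F :=
  fderiv ℝ s y a + chartChristoffel G y (s y) a

/-- The covariant derivative `(a, b) ↦ (∇_a A) b` at `y` of a field `A` of endomorphisms of a
vector space. -/
def chartNablaEnd (G : F → F →L[ℝ] F →L[ℝ] ℝ) (A : F → F →L[ℝ] F) (y : F) : F →L[ℝ] F →L[ℝ] F :=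
  fderiv ℝ A y + ((chartChristoffel G y).comp (A y)).flip -
    (ContinuousLinearMap.compL ℝ F F F (A y)).comp (chartChristoffel G y).flip

/-- The curvature `R(a, b) c = ∇_a ∇_b c - ∇_b ∇_a c` at `y`, for constant vector fields
`a`, `b`, `c` on a vector space. -/
def chartCurvature (G : F → F →L[ℝ] F →L[ℝ] ℝ) (y a b c : F) : F :=
  chartNabla G (fun z ↦ chartChristoffel G z c b) y a -
    chartNabla G (fun z ↦ chartChristoffel G z c a) y b

variable {G : F → F →L[ℝ] F →L[ℝ] ℝ} {y : F}

theorem chartNabla_const (c a : F) :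
    chartNabla G (fun _ ↦ c) y a = chartChristoffel G y c a := by
  simp [chartNabla]

theorem chartNabla_zero (s : F → F) : chartNabla G s y 0 = 0 := by
  simp [chartNabla]

theorem chartNabla_add {s t : F → F} (hs : DifferentiableAt ℝ s y) (ht : DifferentiableAt ℝ t y)
    (a : F) : chartNabla G (fun z ↦ s z + t z) y a = chartNabla G s y a + chartNabla G t y a := by
  simp only [chartNabla, fderiv_fun_add hs ht, map_add, _root_.add_apply]
  abel

theorem chartNablaEnd_apply_field {A : F → F →L[ℝ] F} {s : F → F} (hA : DifferentiableAt ℝ A y)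
    (hs : DifferentiableAt ℝ s y) (a : F) :
    chartNablaEnd G A y a (s y) =
      chartNabla G (fun z ↦ A z (s z)) y a - A y (chartNabla G s y a) := by
  simp only [chartNablaEnd, chartNabla, fderiv_clm_apply hA hs, _root_.add_apply,
    _root_.sub_apply, ContinuousLinearMap.comp_apply, ContinuousLinearMap.flip_apply, map_add,
    ContinuousLinearMap.compL_apply]
  abel

theorem chartCurvature_swap (a b c : F) :
    chartCurvature G y b a c = -chartCurvature G y a b c := by
  simp only [chartCurvature, neg_sub]

theorem apply_chartChristoffel (h : (G y).IsInvertible) (a b c : F) :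
    G y (chartChristoffel G y a b) c = koszulMap (fderiv ℝ G y) a b c := by
  simp only [chartChristoffel, ContinuousLinearMap.comp_apply, ContinuousLinearMap.compL_apply,
    h.self_apply_inverse]

theorem chartChristoffel_eq (h : (G y).IsInvertible) {B : F → F → F} (symm : ∀ a b, B a b = B b a)
    (compat : ∀ a b c, fderiv ℝ G y a b c = G y (B b a) c + G y (B c a) b) (a b : F) :
    chartChristoffel G y a b = B a b := by
  refine h.injective (ContinuousLinearMap.ext fun c ↦ ?_)
  rw [apply_chartChristoffel h, koszulMap_apply, compat, compat, compat, symm b a, symm c a,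
    symm c b]
  ring

/-- A pseudo-Riemannian metric of class `C²` on the open set `U` of a vector space. -/
structure IsMetricOn (G : F → F →L[ℝ] F →L[ℝ] ℝ) (U : Set F) : Prop where
  isOpen : IsOpen U
  contDiffOn : ContDiffOn ℝ 2 G U
  symm : ∀ y ∈ U, ∀ a b, G y a b = G y b a
  isInvertible : ∀ y ∈ U, (G y).IsInvertible

namespace IsMetricOn

variable {U : Set F}

theorem contDiffAt (h : IsMetricOn G U) (hy : y ∈ U) : ContDiffAt ℝ 2 G y :=
  h.contDiffOn.contDiffAt (h.isOpen.mem_nhds hy)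

theorem differentiableAt (h : IsMetricOn G U) (hy : y ∈ U) : DifferentiableAt ℝ G y :=
  (h.contDiffAt hy).differentiableAt (by simp)

theorem contDiffAt_fderiv (h : IsMetricOn G U) (hy : y ∈ U) : ContDiffAt ℝ 1 (fderiv ℝ G) y :=
  (h.contDiffAt hy).fderiv_right (by norm_num [one_add_one_eq_two])

theorem differentiableAt_fderiv (h : IsMetricOn G U) (hy : y ∈ U) :
    DifferentiableAt ℝ (fderiv ℝ G) y :=
  (h.contDiffAt_fderiv hy).differentiableAt (by simp)

theorem fderiv_symm (h : IsMetricOn G U) (hy : y ∈ U) (a b c : F) :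
    fderiv ℝ G y a b c = fderiv ℝ G y a c b := by
  have hG := h.differentiableAt hy
  have key : (fun z ↦ G z b c) =ᶠ[nhds y] fun z ↦ G z c b := by
    filter_upwards [h.isOpen.mem_nhds hy] with z hz using h.symm z hz b c
  rw [← fderiv_apply_const₂ hG, key.fderiv_eq, fderiv_apply_const₂ hG]

theorem fderiv_fderiv_symm (h : IsMetricOn G U) (hy : y ∈ U) (a b : F) :
    fderiv ℝ (fderiv ℝ G) y a b = fderiv ℝ (fderiv ℝ G) y b a :=
  ((h.contDiffAt hy).isSymmSndFDerivAt (by simp)).eq a b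

theorem christoffel_symm (h : IsMetricOn G U) (hy : y ∈ U) (a b : F) :
    chartChristoffel G y a b = chartChristoffel G y b a := by
  refine (h.isInvertible y hy).injective (ContinuousLinearMap.ext fun c ↦ ?_)
  simp only [apply_chartChristoffel (h.isInvertible y hy), koszulMap_apply,
    h.fderiv_symm hy c a b]
  ring

theorem fderiv_apply (h : IsMetricOn G U) (hy : y ∈ U) (a b c : F) :
    fderiv ℝ G y a b c =
      G y (chartChristoffel G y b a) c + G y (chartChristoffel G y c a) b := by
  simp only [apply_chartChristoffel (h.isInvertible y hy), koszulMap_apply]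
  linarith [h.fderiv_symm hy a c b, h.fderiv_symm hy b c a, h.fderiv_symm hy c b a]

theorem fderiv_apply_fields (h : IsMetricOn G U) (hy : y ∈ U) {s t : F → F}
    (hs : DifferentiableAt ℝ s y) (ht : DifferentiableAt ℝ t y) (a : F) :
    fderiv ℝ (fun z ↦ G z (s z) (t z)) y a =
      G y (chartNabla G s y a) (t y) + G y (s y) (chartNabla G t y a) := by
  have hG := h.differentiableAt hy
  rw [fderiv_clm_apply (hG.clm_apply hs) ht, fderiv_clm_apply hG hs]
  simp only [chartNabla, _root_.add_apply, ContinuousLinearMap.comp_apply,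
    ContinuousLinearMap.flip_apply, map_add, h.fderiv_apply hy]
  rw [h.symm y hy (s y) (chartChristoffel G y (t y) a)]
  ring

variable [CompleteSpace F]

theorem differentiableAt_christoffel (h : IsMetricOn G U) (hy : y ∈ U) :
    DifferentiableAt ℝ (chartChristoffel G) y := by
  have hinv : DifferentiableAt ℝ ContinuousLinearMap.inverse (G y) := by
    obtain ⟨e, he⟩ := h.isInvertible y hy
    rw [← he]
    exact (contDiffAt_map_inverse (n := 1) e).differentiableAt (by simp)
  exact ((ContinuousLinearMap.compL ℝ F (F →L[ℝ] ℝ) F).differentiableAt.comp y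
    (hinv.comp y (h.differentiableAt hy))).clm_comp
      (koszulMap.differentiableAt.comp y (h.differentiableAt_fderiv hy))

theorem differentiableAt_christoffel_apply (h : IsMetricOn G U) (hy : y ∈ U) (a b : F) :
    DifferentiableAt ℝ (fun z ↦ chartChristoffel G z a b) y :=
  ((h.differentiableAt_christoffel hy).clm_apply (differentiableAt_const a)).clm_apply
    (differentiableAt_const b)

theorem fderiv_christoffel_symm (h : IsMetricOn G U) (hy : y ∈ U) (a b c : F) :
    fderiv ℝ (chartChristoffel G) y a b c = fderiv ℝ (chartChristoffel G) y a c b := by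
  have hΓ := h.differentiableAt_christoffel hy
  have key : (fun z ↦ chartChristoffel G z b c) =ᶠ[nhds y] fun z ↦ chartChristoffel G z c b := by
    filter_upwards [h.isOpen.mem_nhds hy] with z hz using h.christoffel_symm hz b c
  rw [← fderiv_apply_const₂ hΓ, key.fderiv_eq, fderiv_apply_const₂ hΓ]

theorem fderiv_fderiv_apply (h : IsMetricOn G U) (hy : y ∈ U) (a b c d : F) :
    fderiv ℝ (fderiv ℝ G) y a b c d =
      G y (chartNabla G (fun z ↦ chartChristoffel G z c b) y a) d +
        G y (chartChristoffel G y c b) (chartChristoffel G y d a) +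
      (G y (chartNabla G (fun z ↦ chartChristoffel G z d b) y a) c +
        G y (chartChristoffel G y d b) (chartChristoffel G y c a)) := by
  have hG := h.differentiableAt hy
  have hΓ := h.differentiableAt_christoffel_apply hy
  have key : (fun z ↦ fderiv ℝ G z b c d) =ᶠ[nhds y] fun z ↦
      G z (chartChristoffel G z c b) d + G z (chartChristoffel G z d b) c := by
    filter_upwards [h.isOpen.mem_nhds hy] with z hz using h.fderiv_apply hz b c d
  have hterm (e f : F) : DifferentiableAt ℝ (fun z ↦ G z (chartChristoffel G z e b) f) y :=
    (hG.clm_apply (hΓ e b)).clm_apply (differentiableAt_const f)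
  rw [← fderiv_apply_const (h.differentiableAt_fderiv hy),
    ← fderiv_apply_const₂ ((h.differentiableAt_fderiv hy).clm_apply (differentiableAt_const b)),
    key.fderiv_eq, fderiv_fun_add (hterm c d) (hterm d c), _root_.add_apply,
    h.fderiv_apply_fields hy (hΓ c b) (differentiableAt_const d),
    h.fderiv_apply_fields hy (hΓ d b) (differentiableAt_const c), chartNabla_const,
    chartNabla_const]

theorem curvature_skew (h : IsMetricOn G U) (hy : y ∈ U) (a b c d : F) :
    G y (chartCurvature G y a b c) d = -G y (chartCurvature G y a b d) c := by
  have hab := h.fderiv_fderiv_apply hy a b c d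
  rw [h.fderiv_fderiv_symm hy a b, h.fderiv_fderiv_apply hy b a c d] at hab
  simp only [chartCurvature, map_sub, _root_.sub_apply]
  linarith [h.symm y hy (chartChristoffel G y c b) (chartChristoffel G y d a),
    h.symm y hy (chartChristoffel G y c a) (chartChristoffel G y d b)]

end IsMetricOn

end Coordinates

section CoordinateChange

variable {F F' : Type*} [NormedAddCommGroup F] [NormedSpace ℝ F] [NormedAddCommGroup F']
  [NormedSpace ℝ F'] {G : F → F →L[ℝ] F →L[ℝ] ℝ} {G' : F' → F' →L[ℝ] F' →L[ℝ] ℝ}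
  {U : Set F} {U' : Set F'} {τ : F → F'} {y : F}

/-! ### Changes of coordinates -/

/-- The map `τ` is a local isometry of class `C²` at `y` from the metric `G` to the metric `G'`. It
serves for changes of coordinates. -/
structure IsLocalIsometryAt (G : F → F →L[ℝ] F →L[ℝ] ℝ) (G' : F' → F' →L[ℝ] F' →L[ℝ] ℝ)
    (τ : F → F') (y : F) : Prop where
  contDiffAt : ContDiffAt ℝ 2 τ y
  isInvertible : (fderiv ℝ τ y).IsInvertible
  eventually_eq : ∀ᶠ z in nhds y, ∀ a b, G z a b = G' (τ z) (fderiv ℝ τ z a) (fderiv ℝ τ z b)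

namespace IsLocalIsometryAt

theorem differentiableAt (hτ : IsLocalIsometryAt G G' τ y) : DifferentiableAt ℝ τ y :=
  hτ.contDiffAt.differentiableAt (by simp)

theorem differentiableAt_fderiv (hτ : IsLocalIsometryAt G G' τ y) :
    DifferentiableAt ℝ (fderiv ℝ τ) y :=
  (hτ.contDiffAt.fderiv_right (m := 1) (by norm_num [one_add_one_eq_two])).differentiableAt
    (by simp)

theorem fderiv_fderiv_symm (hτ : IsLocalIsometryAt G G' τ y) (a b : F) :
    fderiv ℝ (fderiv ℝ τ) y a b = fderiv ℝ (fderiv ℝ τ) y b a :=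
  (hτ.contDiffAt.isSymmSndFDerivAt (by simp)).eq a b

theorem fderiv_metric (hτ : IsLocalIsometryAt G G' τ y) (hG : DifferentiableAt ℝ G y)
    (hG' : DifferentiableAt ℝ G' (τ y)) (a b c : F) :
    fderiv ℝ G y a b c =
      fderiv ℝ G' (τ y) (fderiv ℝ τ y a) (fderiv ℝ τ y b) (fderiv ℝ τ y c) +
        G' (τ y) (fderiv ℝ (fderiv ℝ τ) y a b) (fderiv ℝ τ y c) +
        G' (τ y) (fderiv ℝ τ y b) (fderiv ℝ (fderiv ℝ τ) y a c) := by
  have hτ' (v : F) : DifferentiableAt ℝ (fun z ↦ fderiv ℝ τ z v) y :=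
    hτ.differentiableAt_fderiv.clm_apply (differentiableAt_const v)
  have hG'τ : DifferentiableAt ℝ (fun z ↦ G' (τ z)) y := hG'.comp y hτ.differentiableAt
  have key : (fun z ↦ G z b c) =ᶠ[nhds y]
      fun z ↦ G' (τ z) (fderiv ℝ τ z b) (fderiv ℝ τ z c) :=
    hτ.eventually_eq.mono fun z hz ↦ hz b c
  rw [← fderiv_apply_const₂ hG, key.fderiv_eq, fderiv_clm_apply (hG'τ.clm_apply (hτ' b)) (hτ' c),
    fderiv_clm_apply hG'τ (hτ' b), fderiv_fun_comp y hG' hτ.differentiableAt]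
  simp only [_root_.add_apply, ContinuousLinearMap.comp_apply, ContinuousLinearMap.flip_apply,
    fderiv_apply_const hτ.differentiableAt_fderiv]
  ring

theorem map_christoffel (hτ : IsLocalIsometryAt G G' τ y) (h : IsMetricOn G U)
    (h' : IsMetricOn G' U') (hy : y ∈ U) (hy' : τ y ∈ U') (a b : F) :
    fderiv ℝ τ y (chartChristoffel G y a b) =
      chartChristoffel G' (τ y) (fderiv ℝ τ y a) (fderiv ℝ τ y b) +
        fderiv ℝ (fderiv ℝ τ) y a b := by
  have hφ := hτ.isInvertible
  rw [chartChristoffel_eq (h.isInvertible y hy) (B := fun a b ↦ (fderiv ℝ τ y).inverse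
    (chartChristoffel G' (τ y) (fderiv ℝ τ y a) (fderiv ℝ τ y b) + fderiv ℝ (fderiv ℝ τ) y a b)),
    hφ.self_apply_inverse]
  · intro a b
    rw [h'.christoffel_symm hy', hτ.fderiv_fderiv_symm]
  · intro a b c
    rw [hτ.fderiv_metric (h.differentiableAt hy) (h'.differentiableAt hy'), h'.fderiv_apply hy',
      hτ.eventually_eq.self_of_nhds, hτ.eventually_eq.self_of_nhds, hφ.self_apply_inverse,
      hφ.self_apply_inverse, hτ.fderiv_fderiv_symm b a, hτ.fderiv_fderiv_symm c a,
      h'.symm _ hy' (fderiv ℝ τ y b)]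
    simp only [map_add, _root_.add_apply]
    ring

theorem map_nabla (hτ : IsLocalIsometryAt G G' τ y) (h : IsMetricOn G U) (h' : IsMetricOn G' U')
    (hy : y ∈ U) (hy' : τ y ∈ U') {s : F → F} {s' : F' → F'} (hs : DifferentiableAt ℝ s y)
    (hs' : DifferentiableAt ℝ s' (τ y)) (hss' : ∀ᶠ z in nhds y, s' (τ z) = fderiv ℝ τ z (s z))
    (a : F) :
    fderiv ℝ τ y (chartNabla G s y a) = chartNabla G' s' (τ y) (fderiv ℝ τ y a) := by
  have key : fderiv ℝ s' (τ y) (fderiv ℝ τ y a) =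
      fderiv ℝ τ y (fderiv ℝ s y a) + fderiv ℝ (fderiv ℝ τ) y a (s y) := by
    rw [← ContinuousLinearMap.comp_apply, ← fderiv_fun_comp y hs' hτ.differentiableAt,
      Filter.EventuallyEq.fderiv_eq hss', fderiv_clm_apply hτ.differentiableAt_fderiv hs]
    rfl
  rw [chartNabla, chartNabla, map_add, key, hτ.map_christoffel h h' hy hy',
    hss'.self_of_nhds, hτ.fderiv_fderiv_symm a (s y)]
  abel

end IsLocalIsometryAt

end CoordinateChange

section ChartLift

variable {F : Type*} [NormedAddCommGroup F] [NormedSpace ℝ F]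

/-! ### Complete lifts in coordinates -/

/-- The complete lift of a metric in the coordinates `(x, v)`. -/
def chartCompleteLift (G : F → F →L[ℝ] F →L[ℝ] ℝ) (w : F × F) : F × F →L[ℝ] F × F →L[ℝ] ℝ :=
  pullForm (G w.1) (.fst ℝ F F) (.snd ℝ F F) + pullForm (G w.1) (.snd ℝ F F) (.fst ℝ F F) +
    pullForm (fderiv ℝ G w.1 w.2) (.fst ℝ F F) (.fst ℝ F F)

theorem chartCompleteLift_apply (G : F → F →L[ℝ] F →L[ℝ] ℝ) (w a b : F × F) :
    chartCompleteLift G w a b = G w.1 a.1 b.2 + G w.1 a.2 b.1 + fderiv ℝ G w.1 w.2 a.1 b.1 :=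
  rfl

/-- The horizontal lift `x ↦ x^H` in the coordinates `(x, v)`; the vertical lift is
`ContinuousLinearMap.inr`. -/
def chartHorizontalLift (G : F → F →L[ℝ] F →L[ℝ] ℝ) (w : F × F) : F →L[ℝ] F × F :=
  .inl ℝ F F - (ContinuousLinearMap.inr ℝ F F).comp (chartChristoffel G w.1 w.2)

@[simp]
theorem chartHorizontalLift_apply (G : F → F →L[ℝ] F →L[ℝ] ℝ) (w : F × F) (a : F) :
    chartHorizontalLift G w a = (a, -chartChristoffel G w.1 w.2 a) := by
  simp [chartHorizontalLift]

/-- The vector `y` in the decomposition `x^H + y^V` in the coordinates `(x, v)`; the vector `x` is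
given by `ContinuousLinearMap.fst`. -/
def chartVerticalPart (G : F → F →L[ℝ] F →L[ℝ] ℝ) (w : F × F) : F × F →L[ℝ] F :=
  .snd ℝ F F + (chartChristoffel G w.1 w.2).comp (.fst ℝ F F)

@[simp]
theorem chartVerticalPart_apply (G : F → F →L[ℝ] F →L[ℝ] ℝ) (w a : F × F) :
    chartVerticalPart G w a = a.2 + chartChristoffel G w.1 w.2 a.1 := rfl

/-- The field of endomorphisms `x^H ↦ (P x)^H + (Q x)^V`, `x^V ↦ (R x)^H + (T x)^V` in the
coordinates `(x, v)`. -/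
def chartBlockLift (G : F → F →L[ℝ] F →L[ℝ] ℝ) (P Q R T : F → F →L[ℝ] F) (w : F × F) :
    F × F →L[ℝ] F × F :=
  (chartHorizontalLift G w).comp
      ((P w.1).comp (.fst ℝ F F) + (R w.1).comp (chartVerticalPart G w)) +
    (ContinuousLinearMap.inr ℝ F F).comp
      ((Q w.1).comp (.fst ℝ F F) + (T w.1).comp (chartVerticalPart G w))

theorem chartBlockLift_apply (G : F → F →L[ℝ] F →L[ℝ] ℝ) (P Q R T : F → F →L[ℝ] F)
    (w a : F × F) :
    chartBlockLift G P Q R T w a =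
      chartHorizontalLift G w (P w.1 a.1 + R w.1 (chartVerticalPart G w a)) +
        (0, Q w.1 a.1 + T w.1 (chartVerticalPart G w a)) := rfl

theorem chartBlockLift_horizontal (G : F → F →L[ℝ] F →L[ℝ] ℝ) (P Q R T : F → F →L[ℝ] F)
    (w : F × F) (b : F) :
    chartBlockLift G P Q R T w (chartHorizontalLift G w b) =
      chartHorizontalLift G w (P w.1 b) + (0, Q w.1 b) := by
  simp [chartBlockLift_apply]

theorem chartBlockLift_vertical (G : F → F →L[ℝ] F →L[ℝ] ℝ) (P Q R T : F → F →L[ℝ] F)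
    (w : F × F) (b : F) :
    chartBlockLift G P Q R T w (0, b) = chartHorizontalLift G w (R w.1 b) + (0, T w.1 b) := by
  simp [chartBlockLift_apply]

namespace IsMetricOn

variable {G : F → F →L[ℝ] F →L[ℝ] ℝ} {U : Set F} {w : F × F}

theorem isInvertible_chartCompleteLift [CompleteSpace F] (h : IsMetricOn G U) (hw : w.1 ∈ U) :
    (chartCompleteLift G w).IsInvertible := by
  have hGw := h.isInvertible w.1 hw
  have hinj : (chartCompleteLift G w).ker = ⊥ := by
    refine LinearMap.ker_eq_bot'.2 fun a ha ↦ ?_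
    have happ (b : F × F) : chartCompleteLift G w a b = 0 := DFunLike.congr_fun ha b
    simp only [chartCompleteLift_apply] at happ
    have h1 : a.1 = 0 := hGw.injective (ContinuousLinearMap.ext fun b ↦ by simpa using happ (0, b))
    have h2 : a.2 = 0 := hGw.injective
      (ContinuousLinearMap.ext fun b ↦ by simpa [h1] using happ (b, 0))
    exact Prod.ext h1 h2
  have hsurj : (chartCompleteLift G w).range = ⊤ := by
    refine LinearMap.range_eq_top.2 fun φ ↦ ?_
    obtain ⟨a, ha⟩ := hGw.surjective (φ.comp (.inr ℝ F F))
    obtain ⟨b, hb⟩ := hGw.surjective (φ.comp (.inl ℝ F F) - fderiv ℝ G w.1 w.2 a)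
    refine ⟨(a, b), ContinuousLinearMap.ext fun c ↦ ?_⟩
    change chartCompleteLift G w (a, b) c = φ c
    rw [chartCompleteLift_apply, ha, hb]
    have hc : φ c = φ (0, c.2) + φ (c.1, 0) := by rw [← map_add]; simp
    simp [hc, add_assoc]
  exact ⟨.ofBijective _ hinj hsurj, ContinuousLinearEquiv.coe_ofBijective _ hinj hsurj⟩

theorem differentiableAt_chartCompleteLift (h : IsMetricOn G U) (hw : w.1 ∈ U) :
    DifferentiableAt ℝ (chartCompleteLift G) w := by
  have hG : DifferentiableAt ℝ (fun z : F × F ↦ G z.1) w :=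
    (h.differentiableAt hw).comp w differentiableAt_fst
  have hG' : DifferentiableAt ℝ (fun z : F × F ↦ fderiv ℝ G z.1 z.2) w :=
    ((h.differentiableAt_fderiv hw).comp w differentiableAt_fst).clm_apply differentiableAt_snd
  have hpull {B : F × F → F →L[ℝ] F →L[ℝ] ℝ} (a b : F × F →L[ℝ] F)
      (hB : DifferentiableAt ℝ B w) : DifferentiableAt ℝ (fun z ↦ pullForm (B z) a b) w :=
    (differentiableAt_const _).clm_comp (hB.clm_comp (differentiableAt_const _))
  exact ((hpull _ _ hG).add (hpull _ _ hG)).add (hpull _ _ hG')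

theorem fderiv_chartCompleteLift (h : IsMetricOn G U) (hw : w.1 ∈ U) (a b c : F × F) :
    fderiv ℝ (chartCompleteLift G) w a b c =
      fderiv ℝ G w.1 a.1 b.1 c.2 + fderiv ℝ G w.1 a.1 b.2 c.1 +
        (fderiv ℝ (fderiv ℝ G) w.1 a.1 w.2 b.1 c.1 + fderiv ℝ G w.1 a.2 b.1 c.1) := by
  have hG := h.differentiableAt hw
  have hG' := h.differentiableAt_fderiv hw
  have hGbc (b c : F) : DifferentiableAt ℝ (fun z : F × F ↦ G z.1 b c) w :=
    differentiableAt_comp_fst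
      ((hG.clm_apply (differentiableAt_const b)).clm_apply (differentiableAt_const c))
  have hfGbc (b c : F) : fderiv ℝ (fun z : F × F ↦ G z.1 b c) w a = fderiv ℝ G w.1 a.1 b c := by
    rw [fderiv_apply_const₂ (differentiableAt_comp_fst hG), fderiv_comp_fst hG]
  have hGv := differentiableAt_apply_fst_snd hG'
  have hGvbc : DifferentiableAt ℝ (fun z : F × F ↦ fderiv ℝ G z.1 z.2 b.1 c.1) w :=
    (hGv.clm_apply (differentiableAt_const b.1)).clm_apply (differentiableAt_const c.1)
  rw [← fderiv_apply_const₂ (h.differentiableAt_chartCompleteLift hw)]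
  simp only [chartCompleteLift_apply]
  rw [fderiv_fun_add ((hGbc _ _).fun_add (hGbc _ _)) hGvbc, fderiv_fun_add (hGbc _ _) (hGbc _ _)]
  simp only [_root_.add_apply, hfGbc, fderiv_apply_const₂ hGv,
    fderiv_apply_fst_snd hG']

theorem chartCompleteLift_eq (h : IsMetricOn G U) (hw : w.1 ∈ U) (a b : F × F) :
    chartCompleteLift G w a b =
      G w.1 a.1 (chartVerticalPart G w b) + G w.1 (chartVerticalPart G w a) b.1 := by
  simp only [chartCompleteLift_apply, chartVerticalPart_apply, map_add, _root_.add_apply,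
    h.fderiv_apply hw, h.christoffel_symm hw w.2, h.symm w.1 hw a.1 (chartChristoffel G w.1 _ _)]
  ring

theorem chartCompleteLift_horizontal_add_vertical (h : IsMetricOn G U) (hw : w.1 ∈ U) (a b : F)
    (c : F × F) :
    chartCompleteLift G w (chartHorizontalLift G w a + (0, b)) c =
      G w.1 a (chartVerticalPart G w c) + G w.1 b c.1 := by
  rw [h.chartCompleteLift_eq hw]
  simp

variable [CompleteSpace F]

theorem christoffel_chartCompleteLift (h : IsMetricOn G U) (hw : w.1 ∈ U) (a b : F × F) :
    chartChristoffel (chartCompleteLift G) w a b =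
      (chartChristoffel G w.1 a.1 b.1, fderiv ℝ (chartChristoffel G) w.1 w.2 a.1 b.1 +
        chartChristoffel G w.1 a.1 b.2 + chartChristoffel G w.1 a.2 b.1) := by
  refine chartChristoffel_eq (h.isInvertible_chartCompleteLift hw) (B := fun a b ↦
    (chartChristoffel G w.1 a.1 b.1, fderiv ℝ (chartChristoffel G) w.1 w.2 a.1 b.1 +
        chartChristoffel G w.1 a.1 b.2 + chartChristoffel G w.1 a.2 b.1)) ?_ ?_ a b
  · intro a b
    rw [h.christoffel_symm hw a.1 b.1, h.christoffel_symm hw a.1 b.2,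
      h.christoffel_symm hw a.2 b.1, h.fderiv_christoffel_symm hw w.2 a.1 b.1]
    ext <;> simp [add_right_comm]
  · intro a b c
    simp only [chartCompleteLift_apply, h.fderiv_chartCompleteLift hw,
      h.fderiv_fderiv_symm hw a.1 w.2, h.fderiv_fderiv_apply hw, h.fderiv_apply hw, chartNabla,
      fderiv_apply_const₂ (h.differentiableAt_christoffel hw), map_add, _root_.add_apply]
    rw [h.symm w.1 hw (chartChristoffel G w.1 b.1 w.2) (chartChristoffel G w.1 c.1 a.1),
      h.symm w.1 hw (chartChristoffel G w.1 c.1 w.2) (chartChristoffel G w.1 b.1 a.1)]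
    ring

variable {β : F → F}

theorem chartNabla_vertical (h : IsMetricOn G U) (hw : w.1 ∈ U)
    (hβ : DifferentiableAt ℝ β w.1) (a : F × F) :
    chartNabla (chartCompleteLift G) (fun z ↦ (0, β z.1)) w a = (0, chartNabla G β w.1 a.1) := by
  have e : fderiv ℝ (fun z : F × F ↦ ((0 : F), β z.1)) w a = (0, fderiv ℝ β w.1 a.1) := by
    rw [(differentiableAt_const (0 : F)).fderiv_prodMk (differentiableAt_comp_fst hβ)]
    simp [fderiv_comp_fst hβ]
  rw [chartNabla, e, h.christoffel_chartCompleteLift hw]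
  simp [chartNabla]

theorem chartNabla_horizontal (h : IsMetricOn G U) (hw : w.1 ∈ U)
    (hβ : DifferentiableAt ℝ β w.1) (a : F × F) :
    chartNabla (chartCompleteLift G) (fun z ↦ chartHorizontalLift G z (β z.1)) w a =
      chartHorizontalLift G w (chartNabla G β w.1 a.1) +
        (0, chartCurvature G w.1 w.2 a.1 (β w.1)) := by
  have hΓ := h.differentiableAt_christoffel hw
  have hβ' := differentiableAt_comp_fst (V := F) hβ
  have hΓv := differentiableAt_apply_fst_snd hΓ
  have e : fderiv ℝ (fun z ↦ chartHorizontalLift G z (β z.1)) w a =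
      (fderiv ℝ β w.1 a.1, -(chartChristoffel G w.1 w.2 (fderiv ℝ β w.1 a.1) +
        (fderiv ℝ (chartChristoffel G) w.1 a.1 w.2 + chartChristoffel G w.1 a.2) (β w.1))) := by
    simp only [chartHorizontalLift_apply]
    rw [hβ'.fderiv_prodMk (hΓv.clm_apply hβ').fun_neg, fderiv_fun_neg, fderiv_clm_apply hΓv hβ']
    simp [fderiv_comp_fst hβ, fderiv_apply_fst_snd hΓ]
  rw [chartNabla, e, h.christoffel_chartCompleteLift hw]
  ext
  · simp [chartNabla]
  · simp only [chartNabla, chartCurvature, chartHorizontalLift_apply, Prod.snd_add, map_add,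
      map_neg, _root_.add_apply, _root_.neg_apply, fderiv_apply_const₂ hΓ]
    rw [h.fderiv_christoffel_symm hw a.1 w.2, h.christoffel_symm hw a.2,
      h.christoffel_symm hw w.2 (fderiv ℝ β w.1 a.1), h.christoffel_symm hw w.2 (β w.1),
      h.christoffel_symm hw w.2 (chartChristoffel G w.1 (β w.1) a.1)]
    abel

variable {P Q R T : F → F →L[ℝ] F}

theorem differentiableAt_chartHorizontalLift (h : IsMetricOn G U) (hw : w.1 ∈ U) :
    DifferentiableAt ℝ (chartHorizontalLift G) w :=
  (differentiableAt_const _).sub ((differentiableAt_const _).clm_comp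
    (differentiableAt_apply_fst_snd (h.differentiableAt_christoffel hw)))

theorem differentiableAt_chartVerticalPart (h : IsMetricOn G U) (hw : w.1 ∈ U) :
    DifferentiableAt ℝ (chartVerticalPart G) w :=
  (differentiableAt_const _).add ((differentiableAt_apply_fst_snd
    (h.differentiableAt_christoffel hw)).clm_comp (differentiableAt_const _))

theorem differentiableAt_chartBlockLift (h : IsMetricOn G U) (hw : w.1 ∈ U)
    (hP : DifferentiableAt ℝ P w.1) (hQ : DifferentiableAt ℝ Q w.1)
    (hR : DifferentiableAt ℝ R w.1) (hT : DifferentiableAt ℝ T w.1) :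
    DifferentiableAt ℝ (chartBlockLift G P Q R T) w := by
  have hpart {X Y : F → F →L[ℝ] F} (hX : DifferentiableAt ℝ X w.1)
      (hY : DifferentiableAt ℝ Y w.1) : DifferentiableAt ℝ
        (fun z ↦ (X z.1).comp (.fst ℝ F F) + (Y z.1).comp (chartVerticalPart G z)) w :=
    ((differentiableAt_comp_fst hX).clm_comp (differentiableAt_const _)).add
      ((differentiableAt_comp_fst hY).clm_comp (h.differentiableAt_chartVerticalPart hw))
  exact ((h.differentiableAt_chartHorizontalLift hw).clm_comp (hpart hP hR)).add
    ((differentiableAt_const _).clm_comp (hpart hQ hT))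

theorem chartNablaEnd_blockLift_horizontal_vertical (h : IsMetricOn G U) (hw : w.1 ∈ U)
    (hP : DifferentiableAt ℝ P w.1) (hQ : DifferentiableAt ℝ Q w.1)
    (hR : DifferentiableAt ℝ R w.1) (hT : DifferentiableAt ℝ T w.1) (a b : F) :
    chartNablaEnd (chartCompleteLift G) (chartBlockLift G P Q R T) w
        (chartHorizontalLift G w a) (0, b) =
      chartHorizontalLift G w (chartNablaEnd G R w.1 a b) +
        (0, chartNablaEnd G T w.1 a b + chartCurvature G w.1 w.2 a (R w.1 b)) := by
  have hb := differentiableAt_const (𝕜 := ℝ) (x := w.1) b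
  have hRb := hR.clm_apply hb
  have hTb := hT.clm_apply hb
  have hhor : DifferentiableAt ℝ (fun z : F × F ↦ chartHorizontalLift G z (R z.1 b)) w :=
    (h.differentiableAt_chartHorizontalLift hw).clm_apply (differentiableAt_comp_fst hRb)
  have hver : DifferentiableAt ℝ (fun z : F × F ↦ ((0 : F), T z.1 b)) w :=
    (differentiableAt_const _).prodMk (differentiableAt_comp_fst hTb)
  rw [chartNablaEnd_apply_field (s := fun _ ↦ (0, b))
    (h.differentiableAt_chartBlockLift hw hP hQ hR hT) (differentiableAt_const _)]
  simp only [chartBlockLift_vertical]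
  rw [chartNabla_add hhor hver, h.chartNabla_horizontal hw hRb, h.chartNabla_vertical hw hTb,
    h.chartNabla_vertical hw hb, chartBlockLift_vertical,
    chartNablaEnd_apply_field (s := fun _ ↦ b) hR hb,
    chartNablaEnd_apply_field (s := fun _ ↦ b) hT hb]
  ext
  · simp
  · simp only [chartHorizontalLift_apply, Prod.snd_add, Prod.snd_sub, map_sub]
    abel

theorem chartNablaEnd_blockLift_vertical_horizontal (h : IsMetricOn G U) (hw : w.1 ∈ U)
    (hP : DifferentiableAt ℝ P w.1) (hQ : DifferentiableAt ℝ Q w.1)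
    (hR : DifferentiableAt ℝ R w.1) (hT : DifferentiableAt ℝ T w.1) (a b : F) :
    chartNablaEnd (chartCompleteLift G) (chartBlockLift G P Q R T) w (0, a)
      (chartHorizontalLift G w b) = 0 := by
  have hb := differentiableAt_const (𝕜 := ℝ) (x := w.1) b
  have hPb := hP.clm_apply hb
  have hQb := hQ.clm_apply hb
  have hH := h.differentiableAt_chartHorizontalLift hw
  have hhor : DifferentiableAt ℝ (fun z : F × F ↦ chartHorizontalLift G z (P z.1 b)) w :=
    hH.clm_apply (differentiableAt_comp_fst hPb)
  have hver : DifferentiableAt ℝ (fun z : F × F ↦ ((0 : F), Q z.1 b)) w :=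
    (differentiableAt_const _).prodMk (differentiableAt_comp_fst hQb)
  rw [chartNablaEnd_apply_field (s := fun z ↦ chartHorizontalLift G z b)
    (h.differentiableAt_chartBlockLift hw hP hQ hR hT) (hH.clm_apply (differentiableAt_const b))]
  simp only [chartBlockLift_horizontal]
  rw [chartNabla_add hhor hver, h.chartNabla_horizontal hw hPb, h.chartNabla_vertical hw hQb,
    h.chartNabla_horizontal hw hb]
  simp [chartNabla_zero, chartNabla_const, chartCurvature, Prod.mk_zero_zero]

end IsMetricOn

end ChartLift

section ChartComponents

variable {E : Type*} [NormedAddCommGroup E] [NormedSpace ℝ E]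
  {H : Type*} [TopologicalSpace H] {I : ModelWithCorners ℝ E H}
  {M : Type*} [TopologicalSpace M] [ChartedSpace H M] {p q : M}

/-! ### Tensor fields in charts -/

theorem eventually_mem_chart_source (hq : q ∈ (chartAt H p).source) :
    ∀ᶠ z in nhds q, z ∈ (chartAt H p).source :=
  (chartAt H p).open_source.mem_nhds hq

theorem extChartAt_symm_extChartAt (hq : q ∈ (chartAt H p).source) :
    (extChartAt I p).symm (extChartAt I p q) = q :=
  (extChartAt I p).left_inv (by rwa [extChartAt_source])

theorem extChartAt_mem_target (hq : q ∈ (chartAt H p).source) :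
    extChartAt I p q ∈ (extChartAt I p).target :=
  (extChartAt I p).map_source ((extChartAt_source I p).symm ▸ hq)

theorem extChartAt_symm_mem_chart_source {y : E} (hy : y ∈ (extChartAt I p).target) :
    (extChartAt I p).symm y ∈ (chartAt H p).source := by
  rw [← extChartAt_source I]
  exact (extChartAt I p).map_target hy

theorem eventually_nhds_extChartAt [I.Boundaryless] (hq : q ∈ (chartAt H p).source) {P : E → Prop}
    (h : ∀ᶠ z in nhds q, P (extChartAt I p z)) : ∀ᶠ y in nhds (extChartAt I p q), P y := by
  have hq' : q ∈ (extChartAt I p).source := by rwa [extChartAt_source]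
  have hc : Filter.Tendsto (extChartAt I p).symm (nhds (extChartAt I p q)) (nhds q) := by
    simpa only [ContinuousAt, extChartAt_symm_extChartAt hq] using
      continuousAt_extChartAt_symm' hq'
  filter_upwards [hc.eventually h,
    (isOpen_extChartAt_target p).mem_nhds (extChartAt_mem_target hq)] with y hy hyt
  rwa [(extChartAt I p).right_inv hyt] at hy

variable [IsManifold I 1 M]

theorem frame_components_of_mem (hq : q ∈ (chartAt H p).source) (x : TangentSpace I q) :
    frame p q (components p q x) = x :=
  Trivialization.symmL_continuousLinearMapAt _ hq x

theorem components_frame_of_mem (hq : q ∈ (chartAt H p).source) (a : E) :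
    components (I := I) p q (frame p q a) = a :=
  Trivialization.continuousLinearMapAt_symmL _ hq a

theorem extend_eq_frame (hq : q ∈ (chartAt H p).source) (x : TangentSpace I p) :
    (FiberBundle.extend E x : Π q : M, TangentSpace I q) q = frame p q (components p p x) := by
  rw [frame, Trivialization.symmL_apply _ hq, components,
    Trivialization.continuousLinearMapAt_apply_of_mem ℝ _
      (FiberBundle.mem_baseSet_trivializationAt' p)]
  rfl

theorem components_extend (hq : q ∈ (chartAt H p).source) (x : TangentSpace I p) :
    components p q ((FiberBundle.extend E x : Π q : M, TangentSpace I q) q) =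
      components p p x := by
  rw [extend_eq_frame hq, components_frame_of_mem hq]

/-- The components of a field of bilinear forms in the preferred chart at `p`, as a function on the
model space. -/
def chartMetric (g : FormField I M) (p : M) (y : E) : E →L[ℝ] E →L[ℝ] ℝ :=
  metricComponents g p ((extChartAt I p).symm y)

/-- The components of a field of endomorphisms in the preferred chart at `p`, as a function on the
model space. -/
def chartEnd (A : EndField I M) (p : M) (y : E) : E →L[ℝ] E :=
  (components p ((extChartAt I p).symm y)).comp
    ((A ((extChartAt I p).symm y)).comp (frame p ((extChartAt I p).symm y)))

theorem chartMetric_extChartAt (g : FormField I M) (hq : q ∈ (chartAt H p).source) :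
    chartMetric g p (extChartAt I p q) = metricComponents g p q := by
  rw [chartMetric, extChartAt_symm_extChartAt hq]

theorem apply_eq_chartMetric (g : FormField I M) (hq : q ∈ (chartAt H p).source)
    (x y : TangentSpace I q) :
    g q x y = chartMetric g p (extChartAt I p q) (components p q x) (components p q y) := by
  rw [chartMetric_extChartAt g hq, metricComponents, pullForm_apply, frame_components_of_mem hq,
    frame_components_of_mem hq]

theorem components_apply_eq_chartEnd (A : EndField I M) (hq : q ∈ (chartAt H p).source)
    (x : TangentSpace I q) :
    components p q (A q x) = chartEnd A p (extChartAt I p q) (components p q x) := by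
  rw [chartEnd, extChartAt_symm_extChartAt hq, ContinuousLinearMap.comp_apply,
    ContinuousLinearMap.comp_apply, frame_components_of_mem hq]

theorem mvfderiv_eq_fderiv {V : Type*} [NormedAddCommGroup V] [NormedSpace ℝ V] {f : M → V}
    {f' : E → V} (hq : q ∈ (chartAt H p).source) (hf' : DifferentiableAt ℝ f' (extChartAt I p q))
    (hff' : f =ᶠ[nhds q] fun z ↦ f' (extChartAt I p z)) :
    mvfderiv I f q = (fderiv ℝ f' (extChartAt I p q)).comp (components p q) := by
  have h : HasMFDerivAt I 𝓘(ℝ, V) f q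
      ((fderiv ℝ f' (extChartAt I p q)).comp (mfderiv I 𝓘(ℝ, E) (extChartAt I p) q)) :=
    (hf'.hasFDerivAt.hasMFDerivAt.comp q
      (mdifferentiableAt_extChartAt hq).hasMFDerivAt).congr_of_eventuallyEq hff'
  ext x
  rw [mvfderiv, h.mfderiv, components, TangentBundle.continuousLinearMapAt_trivializationAt hq]
  rfl

section Connection

/-! ### The Levi-Civita connection in the chart at a point -/

variable {g : FormField I M} {G : E → E →L[ℝ] E →L[ℝ] ℝ}

theorem metricDerivative_eq_fderiv (hG : DifferentiableAt ℝ G (extChartAt I p p))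
    (hgG : ∀ᶠ z in nhds p, metricComponents g p z = G (extChartAt I p z)) :
    metricDerivative g p = fderiv ℝ G (extChartAt I p p) := by
  ext a : 1
  simp [metricDerivative, mvfderiv_eq_fderiv (mem_chart_source H p) hG hgG, components_frame]

theorem christoffel_eq_chartChristoffel (hG : DifferentiableAt ℝ G (extChartAt I p p))
    (hgG : ∀ᶠ z in nhds p, metricComponents g p z = G (extChartAt I p z)) (a : E) :
    christoffel g p a = chartChristoffel G (extChartAt I p p) a := by
  have hfirst : christoffelFirst g p a = koszulMap (fderiv ℝ G (extChartAt I p p)) a := by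
    ext b c
    rw [christoffelFirst_apply, metricDerivative_eq_fderiv hG hgG, koszulMap_apply]
  rw [christoffel, hfirst, hgG.self_of_nhds]
  rfl

theorem components_leviCivita_self (hG : DifferentiableAt ℝ G (extChartAt I p p))
    (hgG : ∀ᶠ z in nhds p, metricComponents g p z = G (extChartAt I p z))
    {σ : Π q : M, TangentSpace I q} {s : E → E} (hs : DifferentiableAt ℝ s (extChartAt I p p))
    (hσs : ∀ᶠ z in nhds p, components p z (σ z) = s (extChartAt I p z)) (x : TangentSpace I p) :
    components p p (leviCivita g σ p x) =
      chartNabla G s (extChartAt I p p) (components p p x) := by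
  have h : leviCivita g σ p x = frame p p (mvfderiv I (fun q ↦ components p q (σ q)) p x +
      christoffel g p (components p p (σ p)) (components p p x)) := rfl
  rw [h, components_frame, mvfderiv_eq_fderiv (mem_chart_source H p) hs hσs,
    christoffel_eq_chartChristoffel hG hgG, hσs.self_of_nhds]
  rfl

theorem components_covDerivEnd (hG : DifferentiableAt ℝ G (extChartAt I p p))
    (hgG : ∀ᶠ z in nhds p, metricComponents g p z = G (extChartAt I p z))
    {A : EndField I M} {B : E → E →L[ℝ] E} (hB : DifferentiableAt ℝ B (extChartAt I p p))
    (hAB : ∀ᶠ z in nhds p, ∀ x, components p z (A z x) = B (extChartAt I p z) (components p z x))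
    (x y : TangentSpace I p) :
    components p p (covDerivEnd (leviCivita g) A p x y) =
      chartNablaEnd G B (extChartAt I p p) (components p p x) (components p p y) := by
  have near := eventually_mem_chart_source (mem_chart_source H p)
  have hconst := differentiableAt_const (𝕜 := ℝ) (x := extChartAt I p p) (components p p y)
  have hAY := components_leviCivita_self hG hgG
    (σ := fun q ↦ A q ((FiberBundle.extend E y : Π q : M, TangentSpace I q) q))
    (s := fun z ↦ B z (components p p y)) (hB.clm_apply hconst) (by
      filter_upwards [hAB, near] with z hz hz'
      rw [hz, components_extend hz']) x
  have hY := components_leviCivita_self hG hgG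
    (σ := (FiberBundle.extend E y : Π q : M, TangentSpace I q)) hconst
    (near.mono fun z hz ↦ components_extend hz y) x
  rw [covDerivEnd, map_sub, hAY, hAB.self_of_nhds, hY,
    chartNablaEnd_apply_field (s := fun _ ↦ components p p y) hB hconst]

theorem apply_covDerivEnd (hG : DifferentiableAt ℝ G (extChartAt I p p))
    (hgG : ∀ᶠ z in nhds p, metricComponents g p z = G (extChartAt I p z))
    {A : EndField I M} {B : E → E →L[ℝ] E} (hB : DifferentiableAt ℝ B (extChartAt I p p))
    (hAB : ∀ᶠ z in nhds p, ∀ x, components p z (A z x) = B (extChartAt I p z) (components p z x))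
    (x y z : TangentSpace I p) :
    g p (covDerivEnd (leviCivita g) A p x y) z =
      G (extChartAt I p p) (chartNablaEnd G B (extChartAt I p p) (components p p x)
        (components p p y)) (components p p z) := by
  rw [← components_covDerivEnd hG hgG hB hAB, ← hgG.self_of_nhds, metricComponents,
    pullForm_apply, frame_components, frame_components]

end Connection

end ChartComponents

section ChartChange

variable {E : Type*} [NormedAddCommGroup E] [NormedSpace ℝ E]
  {H : Type*} [TopologicalSpace H] {I : ModelWithCorners ℝ E H}
  {M : Type*} [TopologicalSpace M] [ChartedSpace H M] {p q z : M}

/-! ### Changes of charts -/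

variable (I) in
/-- The change of coordinates from the preferred chart at `p` to the preferred chart at `q`. -/
def chartChange (p q : M) : E → E := extChartAt I q ∘ (extChartAt I p).symm

theorem chartChange_extChartAt (hp : z ∈ (chartAt H p).source) :
    chartChange I p q (extChartAt I p z) = extChartAt I q z := by
  rw [chartChange, Function.comp_apply, extChartAt_symm_extChartAt hp]

variable [I.Boundaryless]

theorem contDiffAt_chartChange {n : WithTop ℕ∞} [IsManifold I n M] (hp : z ∈ (chartAt H p).source)
    (hq : z ∈ (chartAt H q).source) : ContDiffAt ℝ n (chartChange I p q) (extChartAt I p z) := by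
  have h := contDiffWithinAt_ext_coord_change (I := I) (n := n) q p (y := extChartAt I p z) (by
    rw [PartialEquiv.trans_source'', PartialEquiv.symm_symm, PartialEquiv.symm_target]
    refine Set.mem_image_of_mem _ ⟨?_, ?_⟩ <;> rwa [extChartAt_source])
  rwa [I.range_eq_univ, contDiffWithinAt_univ] at h

theorem fderiv_chartChange [IsManifold I 1 M] (hp : z ∈ (chartAt H p).source)
    (hq : z ∈ (chartAt H q).source) :
    fderiv ℝ (chartChange I p q) (extChartAt I p z) =
      (components (I := I) q z).comp (frame p z) := by
  ext a
  rw [components, frame, ContinuousLinearMap.comp_apply,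
    TangentBundle.continuousLinearMapAt_trivializationAt_eq_core hq,
    TangentBundle.symmL_trivializationAt_eq_core hp]
  refine Eq.trans ?_ (tangentCoordChange_comp (I := I) (v := a) (w := p) (x := z) (y := q) (z := z)
    ⟨⟨?_, mem_extChartAt_source z⟩, ?_⟩).symm
  · rw [tangentCoordChange_def, I.range_eq_univ, fderivWithin_univ, chartChange]
  all_goals rwa [extChartAt_source]

theorem isLocalIsometryAt_chartChange [IsManifold I 2 M] (g : FormField I M)
    (hp : z ∈ (chartAt H p).source) (hq : z ∈ (chartAt H q).source) :
    IsLocalIsometryAt (chartMetric g p) (chartMetric g q) (chartChange I p q)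
      (extChartAt I p z) where
  contDiffAt := contDiffAt_chartChange hp hq
  isInvertible := by
    rw [fderiv_chartChange hp hq]
    refine .of_inverse (g := (components (I := I) p z).comp (frame q z)) ?_ ?_ <;> ext a <;>
      simp [frame_components_of_mem, components_frame_of_mem, hp, hq]
  eventually_eq := by
    refine eventually_nhds_extChartAt hp ?_
    filter_upwards [eventually_mem_chart_source hp, eventually_mem_chart_source hq]
      with y hyp hyq a b
    simp only [fderiv_chartChange hyp hyq, chartChange_extChartAt hyp, chartMetric_extChartAt g hyp,
      chartMetric_extChartAt g hyq, metricComponents, pullForm_apply,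
      ContinuousLinearMap.comp_apply, frame_components_of_mem hyq]

end ChartChange

section PseudoRiemannian

variable {E : Type*} [NormedAddCommGroup E] [NormedSpace ℝ E]
  {H : Type*} [TopologicalSpace H] {I : ModelWithCorners ℝ E H}
  {M : Type*} [TopologicalSpace M] [ChartedSpace H M]

/-- Pseudo-Riemannian metrics of class `C²`, of arbitrary signature, so that the curvature of the
Levi-Civita connection is defined. -/
structure IsPseudoRiemannian [IsManifold I 1 M] (g : FormField I M) : Prop where
  symm : ∀ p x y, g p x y = g p y x
  nondegenerate : ∀ p x, (∀ y, g p x y = 0) → x = 0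
  contMDiff : ContMDiff I (I.prod 𝓘(ℝ, E →L[ℝ] E →L[ℝ] ℝ)) 2
    fun p ↦ TotalSpace.mk' (E →L[ℝ] E →L[ℝ] ℝ)
      (E := fun p : M ↦ TangentSpace I p →L[ℝ] TangentSpace I p →L[ℝ] ℝ) p (g p)

variable [IsManifold I ∞ M]

theorem AlmostNordenStructure.isPseudoRiemannian (S : AlmostNordenStructure I M) :
    IsPseudoRiemannian S.g where
  symm := S.g_symm
  nondegenerate := S.g_nondegenerate
  contMDiff := S.g_smooth.of_le (WithTop.coe_le_coe.2 le_top)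

theorem contMDiffAt_frame {p q : M} (hq : q ∈ (chartAt H p).source) (a : E) :
    ContMDiffAt I (I.prod 𝓘(ℝ, E)) ∞
      (fun z ↦ TotalSpace.mk' E (E := (TangentSpace I : M → Type _)) z (frame p z a)) q := by
  rw [(trivializationAt E (TangentSpace I : M → Type _) p).contMDiffAt_section_iff
    (s := fun z ↦ frame (I := I) p z a) hq]
  refine (contMDiffAt_const (c := a)).congr_of_eventuallyEq ?_
  filter_upwards [eventually_mem_chart_source hq] with z hz
  rw [← Trivialization.continuousLinearMapAt_apply_of_mem ℝ _ hz]
  exact components_frame_of_mem hz a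

theorem isInvertible_of_nondegenerate [FiniteDimensional ℝ E] {B : E →L[ℝ] E →L[ℝ] ℝ}
    (h : ∀ a, (∀ b, B a b = 0) → a = 0) : B.IsInvertible := by
  have hdim : Module.finrank ℝ E = Module.finrank ℝ (E →L[ℝ] ℝ) := by
    rw [← LinearMap.toContinuousLinearMap.finrank_eq]
    exact Subspace.dual_finrank_eq.symm
  have hinj : Function.Injective B.toLinearMap :=
    (injective_iff_map_eq_zero _).2 fun a ha ↦ h a fun b ↦ DFunLike.congr_fun ha b
  exact ⟨(LinearEquiv.ofInjectiveOfFinrankEq B.toLinearMap hinj hdim).toContinuousLinearEquiv, rfl⟩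

section Smoothness

variable [I.Boundaryless] {g : FormField I M} {A : EndField I M}

theorem contDiffOn_chart {V : Type*} [NormedAddCommGroup V] [NormedSpace ℝ V] {n : ℕ} {p : M}
    {f : M → V} (hf : ∀ q ∈ (chartAt H p).source, ContMDiffAt I 𝓘(ℝ, V) n f q) :
    ContDiffOn ℝ n (fun y ↦ f ((extChartAt I p).symm y)) (extChartAt I p).target := fun y hy ↦
  ((hf _ (extChartAt_symm_mem_chart_source hy)).comp y
    ((contMDiffOn_extChartAt_symm p).contMDiffAt
      ((isOpen_extChartAt_target p).mem_nhds hy))).contDiffAt.contDiffWithinAt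

theorem IsPseudoRiemannian.isMetricOn [FiniteDimensional ℝ E] (hg : IsPseudoRiemannian g) (p : M) :
    IsMetricOn (chartMetric g p) (extChartAt I p).target where
  isOpen := isOpen_extChartAt_target p
  contDiffOn := by
    have : IsManifold I (2 + 1) M := .of_le (n := ∞) (WithTop.coe_le_coe.2 le_top)
    refine contDiffOn_clm_apply.2 fun a ↦ contDiffOn_clm_apply.2 fun b ↦
      contDiffOn_chart (n := 2) (f := fun q ↦ g q (frame p q a) (frame p q b)) fun q hq ↦ ?_
    have hframe := fun a : E ↦
      (contMDiffAt_frame (I := I) hq a).of_le (m := 2) (WithTop.coe_le_coe.2 le_top)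
    exact (contMDiffAt_totalSpace.1 (ContMDiffAt.clm_bundle_apply₂ (F₁ := E) (F₂ := E)
      (F₃ := ℝ) (E₃ := Bundle.Trivial M ℝ) hg.contMDiff.contMDiffAt (hframe a) (hframe b))).2
  symm _ _ _ _ := hg.symm _ _ _
  isInvertible y hy := by
    have hz := extChartAt_symm_mem_chart_source hy
    refine isInvertible_of_nondegenerate fun a ha ↦ ?_
    have hframe : frame (I := I) p ((extChartAt I p).symm y) a = 0 :=
      hg.nondegenerate _ _ fun v ↦ by
        rw [← frame_components_of_mem hz v]
        exact ha _
    rw [← components_frame_of_mem (I := I) hz a, hframe, map_zero]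

theorem differentiableAt_chartEnd (hA : MDifferentiable I (I.prod 𝓘(ℝ, E →L[ℝ] E))
      fun p ↦ TotalSpace.mk' (E →L[ℝ] E)
        (E := fun p : M ↦ TangentSpace I p →L[ℝ] TangentSpace I p) p (A p)) (p : M) :
    DifferentiableAt ℝ (chartEnd A p) (extChartAt I p p) := by
  have h := ((mdifferentiableAt_hom_bundle _).1 (hA p)).2
  have hsymm : MDifferentiableAt 𝓘(ℝ, E) I (extChartAt I p).symm (extChartAt I p p) :=
    ((contMDiffOn_extChartAt_symm p).contMDiffAt (n := 1)
      ((isOpen_extChartAt_target p).mem_nhds (mem_extChartAt_target p))).mdifferentiableAt (by simp)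
  exact (h.comp_of_eq _ hsymm (extChartAt_to_inv p)).differentiableAt

end Smoothness

end PseudoRiemannian

section LeviCivitaChart

variable {E : Type*} [NormedAddCommGroup E] [NormedSpace ℝ E]
  {H : Type*} [TopologicalSpace H] {I : ModelWithCorners ℝ E H} [I.Boundaryless]
  {M : Type*} [TopologicalSpace M] [ChartedSpace H M] [IsManifold I ∞ M]
  {p q : M}

/-! ### The Levi-Civita connection and the curvature in a chart -/

theorem mpullbackWithin_extend (x : TangentSpace I p) :
    VectorField.mpullbackWithin 𝓘(ℝ, E) I (extChartAt I p).symm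
      (FiberBundle.extend E x : Π q : M, TangentSpace I q) (Set.range I)
      =ᶠ[nhds (extChartAt I p p)] fun _ ↦ components p p x := by
  filter_upwards [(isOpen_extChartAt_target p).mem_nhds (mem_extChartAt_target (I := I) p)]
    with y hy
  rw [VectorField.mpullbackWithin_apply]
  refine (isInvertible_mfderivWithin_extChartAt_symm hy).inverse_apply_eq.2 ?_
  rw [extend_eq_frame (extChartAt_symm_mem_chart_source hy), frame,
    TangentBundle.symmL_trivializationAt (extChartAt_symm_mem_chart_source hy),
    (extChartAt I p).right_inv hy]
  rfl

theorem mlieBracket_extend (x y : TangentSpace I p) :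
    VectorField.mlieBracket I (FiberBundle.extend E x : Π q : M, TangentSpace I q)
      (FiberBundle.extend E y : Π q : M, TangentSpace I q) p = 0 := by
  have h := (mpullbackWithin_extend x).lieBracketWithin_vectorField_eq_nhds (𝕜 := ℝ)
    (s := Set.range I) (mpullbackWithin_extend y)
  have hconst : VectorField.lieBracketWithin ℝ (fun _ : E ↦ components p p x)
      (fun _ ↦ components p p y) (Set.range I) (extChartAt I p p) = 0 := by
    simp [VectorField.lieBracketWithin]
  rw [← VectorField.mlieBracketWithin_univ, VectorField.mlieBracketWithin_apply, Set.preimage_univ,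
    Set.univ_inter]
  exact (congrArg _ (h.trans hconst)).trans (map_zero _)

variable [FiniteDimensional ℝ E] {g : FormField I M}

theorem components_leviCivita (hg : IsPseudoRiemannian g) (hq : q ∈ (chartAt H p).source)
    {σ : Π q : M, TangentSpace I q} {s : E → E} (hs : DifferentiableAt ℝ s (extChartAt I p q))
    (hσs : ∀ᶠ z in nhds q, components p z (σ z) = s (extChartAt I p z)) (x : TangentSpace I q) :
    components p q (leviCivita g σ q x) =
      chartNabla (chartMetric g p) s (extChartAt I p q) (components p q x) := by
  have hqq := mem_chart_source H q
  have hτq := chartChange_extChartAt (I := I) (q := p) hqq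
  have hτ := isLocalIsometryAt_chartChange g hqq hq
  let s' : E → E := fun y ↦
    fderiv ℝ (chartChange I p q) (chartChange I q p y) (s (chartChange I q p y))
  have hs' : DifferentiableAt ℝ s' (extChartAt I q q) := by
    have hd := (isLocalIsometryAt_chartChange g hq hqq).differentiableAt_fderiv
    rw [← hτq] at hd hs
    exact (hd.comp _ hτ.differentiableAt).clm_apply (hs.comp _ hτ.differentiableAt)
  have hσs' : ∀ᶠ z in nhds q, components q z (σ z) = s' (extChartAt I q z) := by
    filter_upwards [hσs, eventually_mem_chart_source hq, eventually_mem_chart_source hqq]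
      with z hz hzp hzq
    simp only [s', chartChange_extChartAt hzq, fderiv_chartChange hzp hzq, ← hz,
      ContinuousLinearMap.comp_apply, frame_components_of_mem hzp]
  have hss' : ∀ᶠ y in nhds (extChartAt I q q),
      s (chartChange I q p y) = fderiv ℝ (chartChange I q p) y (s' y) := by
    refine eventually_nhds_extChartAt hqq ?_
    filter_upwards [eventually_mem_chart_source hq, eventually_mem_chart_source hqq]
      with z hzp hzq
    simp only [s', chartChange_extChartAt hzq, fderiv_chartChange hzp hzq,
      fderiv_chartChange hzq hzp, ContinuousLinearMap.comp_apply, frame_components_of_mem hzq,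
      components_frame_of_mem hzp]
  have hmap := hτ.map_nabla (hg.isMetricOn q) (hg.isMetricOn p) (mem_extChartAt_target q)
    (hτq ▸ extChartAt_mem_target hq) hs' (hτq ▸ hs) hss' (components q q x)
  rwa [← components_leviCivita_self ((hg.isMetricOn q).differentiableAt (mem_extChartAt_target q))
    ((eventually_mem_chart_source hqq).mono fun z hz ↦ (chartMetric_extChartAt g hz).symm)
    hs' hσs', fderiv_chartChange hqq hq, hτq, ContinuousLinearMap.comp_apply, frame_components,
    ContinuousLinearMap.comp_apply, frame_components] at hmap

theorem components_leviCivita_extend (hg : IsPseudoRiemannian g) (hq : q ∈ (chartAt H p).source)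
    (y : TangentSpace I p) (x : TangentSpace I q) :
    components p q (leviCivita g (FiberBundle.extend E y : Π q : M, TangentSpace I q) q x) =
      chartChristoffel (chartMetric g p) (extChartAt I p q) (components p p y)
        (components p q x) := by
  rw [components_leviCivita hg hq (differentiableAt_const (components p p y))
    ((eventually_mem_chart_source hq).mono fun q hq ↦ components_extend hq y), chartNabla_const]

theorem components_leviCivita_leviCivita_extend (hg : IsPseudoRiemannian g)
    (x y z : TangentSpace I p) :
    components p p (leviCivita g (fun q ↦ leviCivita g
        (FiberBundle.extend E z : Π q : M, TangentSpace I q) q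
        ((FiberBundle.extend E y : Π q : M, TangentSpace I q) q)) p x) =
      chartNabla (chartMetric g p)
        (fun v ↦ chartChristoffel (chartMetric g p) v (components p p z) (components p p y))
        (extChartAt I p p) (components p p x) := by
  have := FiniteDimensional.complete ℝ E
  refine components_leviCivita hg (mem_chart_source H p)
    ((hg.isMetricOn p).differentiableAt_christoffel_apply (mem_extChartAt_target p) _ _) ?_ x
  filter_upwards [eventually_mem_chart_source (mem_chart_source H p)] with q hq
  rw [components_leviCivita_extend hg hq, components_extend hq]

theorem components_curvature (hg : IsPseudoRiemannian g) (x y z : TangentSpace I p) :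
    components p p (curvature (leviCivita g) p x y z) =
      chartCurvature (chartMetric g p) (extChartAt I p p) (components p p x) (components p p y)
        (components p p z) := by
  simp only [curvature, mlieBracket_extend, map_zero, sub_zero, map_sub,
    components_leviCivita_leviCivita_extend hg, chartCurvature]

theorem curvatureTensor_eq_chartMetric (hg : IsPseudoRiemannian g) (x y z w : TangentSpace I p) :
    curvatureTensor g p x y z w =
      chartMetric g p (extChartAt I p p) (chartCurvature (chartMetric g p) (extChartAt I p p)
        (components p p x) (components p p y) (components p p z)) (components p p w) := by
  rw [curvatureTensor, apply_eq_chartMetric g (mem_chart_source H p), components_curvature hg]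

theorem structureTensor_eq_chartMetric (hg : IsPseudoRiemannian g) {A : EndField I M}
    (hA : DifferentiableAt ℝ (chartEnd A p) (extChartAt I p p)) (x y z : TangentSpace I p) :
    structureTensor g A p x y z =
      chartMetric g p (extChartAt I p p) (chartNablaEnd (chartMetric g p) (chartEnd A p)
        (extChartAt I p p) (components p p x) (components p p y)) (components p p z) :=
  apply_covDerivEnd ((hg.isMetricOn p).differentiableAt (mem_extChartAt_target p))
    ((eventually_mem_chart_source (mem_chart_source H p)).mono fun _ hz ↦
      (chartMetric_extChartAt g hz).symm) hA
    ((eventually_mem_chart_source (mem_chart_source H p)).mono fun _ hz ↦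
      components_apply_eq_chartEnd A hz) x y z

end LeviCivitaChart

section MetricTrace

/-! ### Traces with respect to a metric -/

variable {V W : Type*} [AddCommGroup V] [Module ℝ V] [AddCommGroup W] [Module ℝ W]

theorem trace_eq_trace_fst_add_trace_snd [FiniteDimensional ℝ V] (K : V × V →ₗ[ℝ] V × V) :
    LinearMap.trace ℝ (V × V) K =
      LinearMap.trace ℝ V (LinearMap.fst ℝ V V ∘ₗ K ∘ₗ LinearMap.inl ℝ V V) +
        LinearMap.trace ℝ V (LinearMap.snd ℝ V V ∘ₗ K ∘ₗ LinearMap.inr ℝ V V) := by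
  have hsum : K = LinearMap.inl ℝ V V ∘ₗ (LinearMap.fst ℝ V V ∘ₗ K) +
      LinearMap.inr ℝ V V ∘ₗ (LinearMap.snd ℝ V V ∘ₗ K) := by
    ext <;> simp
  nth_rewrite 1 [hsum]
  rw [map_add, LinearMap.trace_comp_comm' (LinearMap.fst ℝ V V ∘ₗ K),
    LinearMap.trace_comp_comm' (LinearMap.snd ℝ V V ∘ₗ K), LinearMap.comp_assoc,
    LinearMap.comp_assoc]

variable [TopologicalSpace V] [TopologicalSpace W] {g : V →L[ℝ] V →L[ℝ] ℝ} {g' : W →L[ℝ] W →L[ℝ] ℝ}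

theorem nondegenerate_of_prod (hg : g.toLinearMap₁₂.Nondegenerate) (Φ : (V × V) ≃ₗ[ℝ] W)
    (hg' : ∀ a b, g' (Φ a) (Φ b) = g a.1 b.2 + g a.2 b.1) : g'.toLinearMap₁₂.Nondegenerate := by
  constructor
  · intro x hx
    obtain ⟨a, rfl⟩ := Φ.surjective x
    have h₁ : a.1 = 0 := hg.1 _ fun y ↦ by simpa [hg'] using hx (Φ (0, y))
    have h₂ : a.2 = 0 := hg.1 _ fun y ↦ by simpa [hg'] using hx (Φ (y, 0))
    rw [show a = 0 from Prod.ext h₁ h₂, map_zero]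
  · intro x hx
    obtain ⟨a, rfl⟩ := Φ.surjective x
    have h₁ : a.1 = 0 := hg.2 _ fun y ↦ by simpa [hg'] using hx (Φ (0, y))
    have h₂ : a.2 = 0 := hg.2 _ fun y ↦ by simpa [hg'] using hx (Φ (y, 0))
    rw [show a = 0 from Prod.ext h₁ h₂, map_zero]

variable [FiniteDimensional ℝ V] [FiniteDimensional ℝ W]

theorem metricTrace_add (g : V →L[ℝ] V →L[ℝ] ℝ) (B B' : V → V → ℝ) :
    metricTrace g (fun x y ↦ B x y + B' x y) = metricTrace g B + metricTrace g B' := by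
  simp only [metricTrace, mul_add, Finset.sum_add_distrib]

theorem metricTrace_neg (g : V →L[ℝ] V →L[ℝ] ℝ) (B : V → V → ℝ) :
    metricTrace g (fun x y ↦ -B x y) = -metricTrace g B := by
  simp only [metricTrace, mul_neg, Finset.sum_neg_distrib]

theorem metricTrace_zero (g : V →L[ℝ] V →L[ℝ] ℝ) : metricTrace g (fun _ _ ↦ 0) = 0 := by
  simp [metricTrace]

theorem metricTrace_eq_trace (hg : g.toLinearMap₁₂.Nondegenerate) (L : V →ₗ[ℝ] V) :
    metricTrace g (fun x y ↦ g y (L x)) = LinearMap.trace ℝ V L := by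
  let e := Module.finBasis ℝ V
  let m := LinearMap.BilinForm.toMatrix e g.toLinearMap₁₂
  have hdet : IsUnit m.det :=
    isUnit_iff_ne_zero.2 ((LinearMap.BilinForm.nondegenerate_iff_det_ne_zero e).1 hg)
  have hcomp : LinearMap.BilinForm.toMatrix e (LinearMap.BilinForm.compRight g.toLinearMap₁₂ L) =
      m * LinearMap.toMatrix e e L :=
    LinearMap.BilinForm.toMatrix_compRight e _ L
  have hsum : metricTrace g (fun x y ↦ g y (L x)) =
      (m⁻¹ * LinearMap.BilinForm.toMatrix e
        (LinearMap.BilinForm.compRight g.toLinearMap₁₂ L)).trace := by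
    have hm : (Matrix.of fun i j ↦ g (e i) (e j)) = m := by
      ext i j
      simp [m, LinearMap.BilinForm.toMatrix_apply]
    simp only [Matrix.trace, Matrix.diag_apply, Matrix.mul_apply,
      LinearMap.BilinForm.toMatrix_apply, LinearMap.BilinForm.compRight_apply,
      ContinuousLinearMap.toLinearMap₁₂_apply_apply_apply, ← hm, metricTrace, e]
  rw [hsum, hcomp, Matrix.nonsing_inv_mul_cancel_left _ _ hdet, ← LinearMap.trace_eq_matrix_trace]

theorem exists_linearMap_of_nondegenerate (hg : g.toLinearMap₁₂.Nondegenerate)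
    (B : V →ₗ[ℝ] V →ₗ[ℝ] ℝ) : ∃ L : V →ₗ[ℝ] V, ∀ x y, B x y = g y (L x) :=
  have hflip := LinearMap.BilinForm.Nondegenerate.flip hg
  ⟨LinearMap.BilinForm.symmCompOfNondegenerate B _ hflip,
    fun x y ↦ (LinearMap.BilinForm.symmCompOfNondegenerate_left_apply B hflip y x).symm⟩

theorem metricTrace_prod (hg : g.toLinearMap₁₂.Nondegenerate) (Φ : (V × V) ≃ₗ[ℝ] W)
    (hg' : ∀ a b, g' (Φ a) (Φ b) = g a.1 b.2 + g a.2 b.1) (B : W →ₗ[ℝ] W →ₗ[ℝ] ℝ) :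
    metricTrace g' (fun x y ↦ B x y) =
      metricTrace g (fun x y ↦ B (Φ (x, 0)) (Φ (0, y))) +
        metricTrace g (fun x y ↦ B (Φ (0, x)) (Φ (y, 0))) := by
  have hnd := nondegenerate_of_prod hg Φ hg'
  obtain ⟨L, hL⟩ := exists_linearMap_of_nondegenerate hnd B
  let K : V × V →ₗ[ℝ] V × V := Φ.symm.toLinearMap ∘ₗ L ∘ₗ Φ.toLinearMap
  have hΦK : ∀ a, L (Φ a) = Φ (K a) := fun a ↦ by simp [K]
  have htrace : LinearMap.trace ℝ W L = LinearMap.trace ℝ (V × V) K :=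
    (LinearMap.trace_conj' L Φ.symm).symm
  simp only [hL, metricTrace_eq_trace hnd, htrace, trace_eq_trace_fst_add_trace_snd,
    ← metricTrace_eq_trace hg, hΦK, hg']
  simp

end MetricTrace

section TangentBundleChart

variable {E : Type*} [NormedAddCommGroup E] [NormedSpace ℝ E]
  {H : Type*} [TopologicalSpace H] {I : ModelWithCorners ℝ E H}
  {M : Type*} [TopologicalSpace M] [ChartedSpace H M] [IsManifold I ∞ M]
  {u w : TangentBundle I M}

/-! ### Charts of the tangent bundle -/

theorem mem_chart_source_tangent (hw : w.proj ∈ (chartAt H u.proj).source) :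
    w ∈ (chartAt (ModelProd H E) u).source :=
  (TangentBundle.mem_chart_source_iff w u).2 hw

theorem extChartAt_tangent (hw : w.proj ∈ (chartAt H u.proj).source) :
    extChartAt I.tangent u w =
      (extChartAt I u.proj w.proj, components u.proj w.proj w.snd) := by
  rw [FiberBundle.extChartAt]
  exact Prod.ext rfl (Trivialization.continuousLinearMapAt_apply_of_mem ℝ
    (trivializationAt E (TangentSpace I : M → Type _) u.proj) hw w.snd).symm

theorem extChartAt_tangent_fst_mem_target (hw : w.proj ∈ (chartAt H u.proj).source) :
    (extChartAt I.tangent u w).1 ∈ (extChartAt I u.proj).target := by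
  rw [extChartAt_tangent hw]
  exact extChartAt_mem_target hw

theorem eventually_proj_mem_chart_source (hw : w.proj ∈ (chartAt H u.proj).source) :
    ∀ᶠ z in nhds w, z.proj ∈ (chartAt H u.proj).source :=
  (eventually_mem_chart_source (mem_chart_source_tangent hw)).mono fun z ↦
    (TangentBundle.mem_chart_source_iff z u).1

variable [I.Boundaryless]

theorem chartChange_tangent (hw : w.proj ∈ (chartAt H u.proj).source) :
    chartChange I.tangent w u =ᶠ[nhds (extChartAt I.tangent w w)] fun y ↦
      (chartChange I w.proj u.proj y.1, fderiv ℝ (chartChange I w.proj u.proj) y.1 y.2) := by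
  have hww := mem_chart_source H w.proj
  refine eventually_nhds_extChartAt (mem_chart_source (ModelProd H E) w) ?_
  filter_upwards [eventually_proj_mem_chart_source hw, eventually_proj_mem_chart_source hww]
    with z hzu hzw
  rw [chartChange_extChartAt (mem_chart_source_tangent hzw), extChartAt_tangent hzu,
    extChartAt_tangent hzw, fderiv_chartChange hzw hzu, chartChange_extChartAt hzw,
    ContinuousLinearMap.comp_apply, frame_components_of_mem hzw]

theorem components_frame_tangent (hw : w.proj ∈ (chartAt H u.proj).source) (a b : E) :
    components (I := I.tangent) u w (frame w w (a, b)) =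
      (fderiv ℝ (chartChange I w.proj u.proj) (extChartAt I w.proj w.proj) a,
        fderiv ℝ (fderiv ℝ (chartChange I w.proj u.proj)) (extChartAt I w.proj w.proj) a
            (components w.proj w.proj w.snd) +
          fderiv ℝ (chartChange I w.proj u.proj) (extChartAt I w.proj w.proj) b) := by
  have hww := mem_chart_source H w.proj
  have hτ : ContDiffAt ℝ ∞ (chartChange I w.proj u.proj) (extChartAt I w.proj w.proj) :=
    contDiffAt_chartChange hww hw
  have hτ' := hτ.differentiableAt (by simp)
  have hfτ := (hτ.fderiv_right (m := ∞) (by simp)).differentiableAt (by simp)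
  have hcomp := DFunLike.congr_fun (fderiv_chartChange (I := I.tangent)
    (mem_chart_source (ModelProd H E) w) (mem_chart_source_tangent hw)) (a, b)
  rw [ContinuousLinearMap.comp_apply] at hcomp
  rw [← hcomp, (chartChange_tangent hw).fderiv_eq, extChartAt_tangent hww,
    DifferentiableAt.fderiv_prodMk (differentiableAt_comp_fst hτ')
      ((differentiableAt_apply_fst_snd hfτ)),
    ContinuousLinearMap.prod_apply, fderiv_comp_fst hτ', fderiv_apply_fst_snd hfτ]

theorem components_verticalLift (hw : w.proj ∈ (chartAt H u.proj).source)
    (x : TangentSpace I w.proj) :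
    components (I := I.tangent) u w (verticalLift w x) = (0, components u.proj w.proj x) := by
  have h : verticalLift w x =
      frame (I := I.tangent) w w ((0, components w.proj w.proj x) : E × E) := rfl
  rw [h, components_frame_tangent hw, fderiv_chartChange (mem_chart_source H w.proj) hw]
  simp [frame_components]

variable [FiniteDimensional ℝ E] {g : FormField I M}

theorem components_horizontalLift (hg : IsPseudoRiemannian g)
    (hw : w.proj ∈ (chartAt H u.proj).source) (x : TangentSpace I w.proj) :
    components (I := I.tangent) u w (horizontalLift (leviCivita g) w x) =
      chartHorizontalLift (chartMetric g u.proj) (extChartAt I.tangent u w)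
        (components u.proj w.proj x) := by
  have hww := mem_chart_source H w.proj
  have hτw := chartChange_extChartAt (I := I) (q := u.proj) hww
  have hτ := isLocalIsometryAt_chartChange g hww hw
  have hmap := hτ.map_christoffel (hg.isMetricOn _) (hg.isMetricOn _) (mem_extChartAt_target _)
    (hτw ▸ extChartAt_mem_target hw) (components w.proj w.proj w.snd)
    (components w.proj w.proj x)
  have h : horizontalLift (leviCivita g) w x = frame (I := I.tangent) w w
      ((components w.proj w.proj x, -components w.proj w.proj
        (leviCivita g (FiberBundle.extend E w.snd : Π q : M, TangentSpace I q) w.proj x)) :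
        E × E) := rfl
  rw [h, components_leviCivita_extend hg hww, components_frame_tangent hw, map_neg, hmap, hτw,
    hτ.fderiv_fderiv_symm (components w.proj w.proj x), fderiv_chartChange hww hw,
    extChartAt_tangent hw, chartHorizontalLift_apply]
  simp [frame_components]

end TangentBundleChart

section LiftChart

variable {E : Type*} [NormedAddCommGroup E] [NormedSpace ℝ E] [FiniteDimensional ℝ E]
  {H : Type*} [TopologicalSpace H] {I : ModelWithCorners ℝ E H}
  {M : Type*} [TopologicalSpace M] [ChartedSpace H M] [IsManifold I ∞ M]
  {g : FormField I M} {u w : TangentBundle I M}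

/-! ### The splitting of the tangent bundle in a chart -/

section Splitting

variable (cov : CovariantDerivative I E (TangentSpace I : M → Type _)) (u : TangentBundle I M)

theorem horizontalLift_add_verticalLift (ξ : TangentSpace I.tangent u) :
    horizontalLift cov u (horizontalPart cov u ξ) + verticalLift u (verticalPart cov u ξ) = ξ :=
  (splitting cov u).apply_symm_apply ξ

@[simp]
theorem horizontalPart_horizontalLift (x : TangentSpace I u.proj) :
    horizontalPart cov u (horizontalLift cov u x) = x :=
  congrArg Prod.fst (splitting_symm_horizontalLift cov u x)

@[simp]
theorem horizontalPart_verticalLift (x : TangentSpace I u.proj) :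
    horizontalPart cov u (verticalLift u x) = 0 :=
  congrArg Prod.fst (splitting_symm_verticalLift cov u x)

@[simp]
theorem verticalPart_horizontalLift (x : TangentSpace I u.proj) :
    verticalPart cov u (horizontalLift cov u x) = 0 :=
  congrArg Prod.snd (splitting_symm_horizontalLift cov u x)

@[simp]
theorem verticalPart_verticalLift (x : TangentSpace I u.proj) :
    verticalPart cov u (verticalLift u x) = x :=
  congrArg Prod.snd (splitting_symm_verticalLift cov u x)

end Splitting

theorem completeLift_apply (g : FormField I M) (u : TangentBundle I M)
    (ξ η : TangentSpace I.tangent u) :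
    completeLift g u ξ η =
      g u.proj (horizontalPart (leviCivita g) u ξ) (verticalPart (leviCivita g) u η) +
        g u.proj (verticalPart (leviCivita g) u ξ) (horizontalPart (leviCivita g) u η) := rfl

/-- The field of endomorphisms `x^H ↦ (P x)^H + (Q x)^V`, `x^V ↦ (R x)^H + (T x)^V` of the tangent
bundle, the common form of `liftJ₁`, `liftJ₂` and `liftJ₃`. -/
def blockLift (g : FormField I M) (P Q R T : EndField I M) :
    EndField I.tangent (TangentBundle I M) := fun u ↦
  letI h := horizontalPart (leviCivita g) u
  letI v := verticalPart (leviCivita g) u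
  (horizontalLift (leviCivita g) u).comp ((P u.proj).comp h + (R u.proj).comp v) +
    (verticalLift u).comp ((Q u.proj).comp h + (T u.proj).comp v)

theorem blockLift_apply (g : FormField I M) (P Q R T : EndField I M) (u : TangentBundle I M)
    (ξ : TangentSpace I.tangent u) :
    blockLift g P Q R T u ξ =
      horizontalLift (leviCivita g) u (P u.proj (horizontalPart (leviCivita g) u ξ) +
          R u.proj (verticalPart (leviCivita g) u ξ)) +
        verticalLift u (Q u.proj (horizontalPart (leviCivita g) u ξ) +
          T u.proj (verticalPart (leviCivita g) u ξ)) := rfl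

theorem liftJ₁_eq_blockLift (g : FormField I M) (J : EndField I M) :
    liftJ₁ g J = blockLift g (-J) 0 0 J := by
  ext u ξ : 2
  simp [blockLift_apply, liftJ₁]

theorem liftJ₂_eq_blockLift (g : FormField I M) :
    liftJ₂ g = blockLift g 0 (fun p ↦ .id ℝ (TangentSpace I p))
      (fun p ↦ -.id ℝ (TangentSpace I p)) 0 := by
  ext u ξ : 2
  simp [blockLift_apply, liftJ₂, sub_eq_neg_add]

theorem liftJ₃_eq_blockLift (g : FormField I M) (J : EndField I M) :
    liftJ₃ g J = blockLift g 0 J J 0 := by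
  ext u ξ : 2
  simp [blockLift_apply, liftJ₃, add_comm]

section Components

variable [I.Boundaryless]

theorem components_eq_horizontal_add_vertical (hg : IsPseudoRiemannian g)
    (hw : w.proj ∈ (chartAt H u.proj).source) (ξ : TangentSpace I.tangent w) :
    components (I := I.tangent) u w ξ =
      chartHorizontalLift (chartMetric g u.proj) (extChartAt I.tangent u w)
          (components u.proj w.proj (horizontalPart (leviCivita g) w ξ)) +
        (0, components u.proj w.proj (verticalPart (leviCivita g) w ξ)) := by
  rw [← components_horizontalLift hg hw, ← components_verticalLift hw, ← map_add,
    horizontalLift_add_verticalLift]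

theorem components_fst (hg : IsPseudoRiemannian g) (hw : w.proj ∈ (chartAt H u.proj).source)
    (ξ : TangentSpace I.tangent w) :
    (components (I := I.tangent) u w ξ).1 =
      components u.proj w.proj (horizontalPart (leviCivita g) w ξ) := by
  rw [components_eq_horizontal_add_vertical hg hw]
  simp

theorem chartVerticalPart_components (hg : IsPseudoRiemannian g)
    (hw : w.proj ∈ (chartAt H u.proj).source) (ξ : TangentSpace I.tangent w) :
    chartVerticalPart (chartMetric g u.proj) (extChartAt I.tangent u w)
        (components (I := I.tangent) u w ξ) =
      components u.proj w.proj (verticalPart (leviCivita g) w ξ) := by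
  rw [components_eq_horizontal_add_vertical hg hw]
  simp

theorem metricComponents_completeLift (hg : IsPseudoRiemannian g)
    (hw : w.proj ∈ (chartAt H u.proj).source) :
    metricComponents (completeLift g) u w =
      chartCompleteLift (chartMetric g u.proj) (extChartAt I.tangent u w) := by
  refine ContinuousLinearMap.ext fun a ↦ ContinuousLinearMap.ext fun b ↦ ?_
  rw [metricComponents, pullForm_apply, completeLift_apply, apply_eq_chartMetric g hw,
    apply_eq_chartMetric g hw, ← components_fst hg hw, ← components_fst hg hw,
    ← chartVerticalPart_components hg hw, ← chartVerticalPart_components hg hw,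
    components_frame_of_mem (mem_chart_source_tangent hw),
    components_frame_of_mem (mem_chart_source_tangent hw),
    (hg.isMetricOn u.proj).chartCompleteLift_eq (extChartAt_tangent_fst_mem_target hw),
    extChartAt_tangent hw]

theorem components_blockLift (hg : IsPseudoRiemannian g)
    (hw : w.proj ∈ (chartAt H u.proj).source) (P Q R T : EndField I M)
    (ξ : TangentSpace I.tangent w) :
    components (I := I.tangent) u w (blockLift g P Q R T w ξ) =
      chartBlockLift (chartMetric g u.proj) (chartEnd P u.proj) (chartEnd Q u.proj)
        (chartEnd R u.proj) (chartEnd T u.proj) (extChartAt I.tangent u w)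
        (components (I := I.tangent) u w ξ) := by
  rw [blockLift_apply, map_add, components_horizontalLift hg hw, components_verticalLift hw,
    chartBlockLift_apply, components_fst hg hw, chartVerticalPart_components hg hw]
  simp only [map_add, components_apply_eq_chartEnd _ hw, extChartAt_tangent hw]

end Components

end LiftChart

section LeeForms

variable {E : Type*} [NormedAddCommGroup E] [NormedSpace ℝ E] [FiniteDimensional ℝ E]
  {H : Type*} [TopologicalSpace H] {I : ModelWithCorners ℝ E H}
  {M : Type*} [TopologicalSpace M] [ChartedSpace H M] [IsManifold I ∞ M]
  {g : FormField I M}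

/-! ### The Lee forms of block lifts -/

theorem metricTrace_completeLift (hg : IsPseudoRiemannian g) (u : TangentBundle I M)
    (B : TangentSpace I.tangent u →ₗ[ℝ] TangentSpace I.tangent u →ₗ[ℝ] ℝ) :
    metricTrace (completeLift g u) (fun ξ η ↦ B ξ η) =
      metricTrace (g u.proj) (fun x y ↦
          B (horizontalLift (leviCivita g) u x) (verticalLift u y)) +
        metricTrace (g u.proj) (fun x y ↦
          B (verticalLift u x) (horizontalLift (leviCivita g) u y)) := by
  have hnd : (g u.proj).toLinearMap₁₂.Nondegenerate :=
    ⟨hg.nondegenerate u.proj, fun x hx ↦ hg.nondegenerate u.proj x fun y ↦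
      (hg.symm u.proj x y).trans (hx y)⟩
  have hsplit : ∀ a b, completeLift g u (splitting (leviCivita g) u a)
      (splitting (leviCivita g) u b) = g u.proj a.1 b.2 + g u.proj a.2 b.1 := by
    rintro ⟨x, y⟩ ⟨x', y'⟩
    simp [completeLift_apply, splitting_apply]
  have htrace := metricTrace_prod hnd (splitting (leviCivita g) u).toLinearEquiv hsplit B
  simpa [splitting_apply] using htrace

variable [I.Boundaryless]

theorem curvatureTensor_swap_swap (hg : IsPseudoRiemannian g) (p : M)
    (x y z w : TangentSpace I p) :
    curvatureTensor g p x y z w = curvatureTensor g p y x w z := by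
  have := FiniteDimensional.complete ℝ E
  rw [curvatureTensor_eq_chartMetric hg, curvatureTensor_eq_chartMetric hg, chartCurvature_swap,
    map_neg, _root_.neg_apply,
    (hg.isMetricOn p).curvature_skew (mem_extChartAt_target p), neg_neg]

section BlockLift

variable {P Q R T : EndField I M} {u : TangentBundle I M}

variable (hg : IsPseudoRiemannian g)
  (hP : DifferentiableAt ℝ (chartEnd P u.proj) (extChartAt I u.proj u.proj))
  (hQ : DifferentiableAt ℝ (chartEnd Q u.proj) (extChartAt I u.proj u.proj))
  (hR : DifferentiableAt ℝ (chartEnd R u.proj) (extChartAt I u.proj u.proj))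
  (hT : DifferentiableAt ℝ (chartEnd T u.proj) (extChartAt I u.proj u.proj))

include hg hP hQ hR hT

theorem structureTensor_blockLift_eq_chart (ξ η ζ : TangentSpace I.tangent u) :
    structureTensor (completeLift g) (blockLift g P Q R T) u ξ η ζ =
      chartCompleteLift (chartMetric g u.proj) (extChartAt I.tangent u u)
        (chartNablaEnd (chartCompleteLift (chartMetric g u.proj))
          (chartBlockLift (chartMetric g u.proj) (chartEnd P u.proj) (chartEnd Q u.proj)
            (chartEnd R u.proj) (chartEnd T u.proj)) (extChartAt I.tangent u u)
          (components (I := I.tangent) u u ξ) (components (I := I.tangent) u u η))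
        (components (I := I.tangent) u u ζ) := by
  have := FiniteDimensional.complete ℝ E
  have hu := mem_chart_source H u.proj
  have hmem := extChartAt_tangent_fst_mem_target (I := I) hu
  have hfst : (extChartAt I.tangent u u).1 = extChartAt I u.proj u.proj := by
    rw [extChartAt_tangent hu]
  have h := hg.isMetricOn u.proj
  have near := eventually_proj_mem_chart_source hu
  rw [← hfst] at hP hQ hR hT
  exact apply_covDerivEnd (h.differentiableAt_chartCompleteLift hmem)
    (near.mono fun w hw ↦ metricComponents_completeLift hg hw)
    (h.differentiableAt_chartBlockLift hmem hP hQ hR hT)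
    (near.mono fun w hw ↦ components_blockLift hg hw P Q R T) ξ η ζ

theorem structureTensor_blockLift_horizontal_vertical (x y : TangentSpace I u.proj)
    (ζ : TangentSpace I.tangent u) :
    structureTensor (completeLift g) (blockLift g P Q R T) u (horizontalLift (leviCivita g) u x)
        (verticalLift u y) ζ =
      structureTensor g R u.proj x y (verticalPart (leviCivita g) u ζ) +
        structureTensor g T u.proj x y (horizontalPart (leviCivita g) u ζ) +
        curvatureTensor g u.proj u.snd x (R u.proj y) (horizontalPart (leviCivita g) u ζ) := by
  have := FiniteDimensional.complete ℝ E
  have hu := mem_chart_source H u.proj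
  have hmem := extChartAt_tangent_fst_mem_target (I := I) hu
  have hfst : (extChartAt I.tangent u u).1 = extChartAt I u.proj u.proj := by
    rw [extChartAt_tangent hu]
  have hsnd : (extChartAt I.tangent u u).2 = components u.proj u.proj u.snd := by
    rw [extChartAt_tangent hu]
  have h := hg.isMetricOn u.proj
  rw [structureTensor_blockLift_eq_chart hg hP hQ hR hT, structureTensor_eq_chartMetric hg hR,
    structureTensor_eq_chartMetric hg hT, curvatureTensor_eq_chartMetric hg,
    components_apply_eq_chartEnd R hu, components_horizontalLift hg hu, components_verticalLift hu]
  rw [← hfst] at hP hQ hR hT ⊢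
  rw [h.chartNablaEnd_blockLift_horizontal_vertical hmem hP hQ hR hT,
    h.chartCompleteLift_horizontal_add_vertical hmem, chartVerticalPart_components hg hu,
    components_fst hg hu, hsnd, map_add, _root_.add_apply, add_assoc]

theorem structureTensor_blockLift_vertical_horizontal (x y : TangentSpace I u.proj)
    (ζ : TangentSpace I.tangent u) :
    structureTensor (completeLift g) (blockLift g P Q R T) u (verticalLift u x)
      (horizontalLift (leviCivita g) u y) ζ = 0 := by
  have := FiniteDimensional.complete ℝ E
  have hu := mem_chart_source H u.proj
  have hfst : (extChartAt I.tangent u u).1 = extChartAt I u.proj u.proj := by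
    rw [extChartAt_tangent hu]
  rw [structureTensor_blockLift_eq_chart hg hP hQ hR hT, components_horizontalLift hg hu,
    components_verticalLift hu]
  rw [← hfst] at hP hQ hR hT
  rw [(hg.isMetricOn u.proj).chartNablaEnd_blockLift_vertical_horizontal
    (extChartAt_tangent_fst_mem_target hu) hP hQ hR hT, map_zero, _root_.zero_apply]

theorem leeForm_blockLift (ζ : TangentSpace I.tangent u) :
    leeForm (completeLift g) (blockLift g P Q R T) u ζ =
      leeForm g R u.proj (verticalPart (leviCivita g) u ζ) +
        leeForm g T u.proj (horizontalPart (leviCivita g) u ζ) +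
        associatedRicci g R u.proj u.snd (horizontalPart (leviCivita g) u ζ) := by
  obtain ⟨B, hB⟩ : ∃ B : TangentSpace I.tangent u →ₗ[ℝ] TangentSpace I.tangent u →ₗ[ℝ] ℝ,
      ∀ ξ η, structureTensor (completeLift g) (blockLift g P Q R T) u ξ η ζ = B ξ η := by
    simp only [structureTensor_blockLift_eq_chart hg hP hQ hR hT]
    generalize chartNablaEnd (F := E × E) _ _ _ = N, chartCompleteLift (F := E) _ _ = G
    exact ⟨.mk₂ ℝ _ (by simp) (by simp) (by simp) (by simp), fun _ _ ↦ rfl⟩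
  simp only [leeForm, hB, metricTrace_completeLift hg]
  simp only [← hB, structureTensor_blockLift_horizontal_vertical hg hP hQ hR hT,
    structureTensor_blockLift_vertical_horizontal hg hP hQ hR hT, metricTrace_zero, add_zero,
    metricTrace_add, curvatureTensor_swap_swap hg _ u.snd, associatedRicci]

end BlockLift

end LeeForms

section StructureLifts

variable {E : Type*} [NormedAddCommGroup E] [NormedSpace ℝ E]
  {H : Type*} [TopologicalSpace H] {I : ModelWithCorners ℝ E H}
  {M : Type*} [TopologicalSpace M] [ChartedSpace H M] [IsManifold I ∞ M] {p : M}

/-! ### The Lee forms of the almost complex structures -/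

theorem chartEnd_apply (A : EndField I M) (p : M) (y a : E) :
    chartEnd A p y a = components p ((extChartAt I p).symm y)
      (A ((extChartAt I p).symm y) (frame p ((extChartAt I p).symm y) a)) := rfl

theorem chartEnd_zero (p : M) : chartEnd (0 : EndField I M) p = 0 := by
  ext y a
  rw [chartEnd_apply, Pi.zero_apply, _root_.zero_apply, map_zero]
  rfl

theorem differentiableAt_chartEnd_zero (p : M) (y : E) :
    DifferentiableAt ℝ (chartEnd (0 : EndField I M) p) y := by
  rw [chartEnd_zero]
  exact differentiableAt_zero y

theorem chartEnd_neg (A : EndField I M) (p : M) : chartEnd (-A) p = -chartEnd A p := by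
  ext y a
  rw [chartEnd_apply, Pi.neg_apply, _root_.neg_apply, map_neg]
  rfl

theorem chartEnd_smul_id (c : ℝ) {y : E} (hy : y ∈ (extChartAt I p).target) :
    chartEnd (fun q ↦ c • .id ℝ (TangentSpace I q)) p y = c • .id ℝ E := by
  ext a
  rw [chartEnd_apply, _root_.smul_apply, ContinuousLinearMap.id_apply, map_smul,
    components_frame_of_mem (extChartAt_symm_mem_chart_source hy)]
  rfl

theorem differentiableAt_chartEnd_smul_id [I.Boundaryless] (c : ℝ) (p : M) :
    DifferentiableAt ℝ (chartEnd (fun q ↦ c • .id ℝ (TangentSpace I q)) p) (extChartAt I p p) :=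
  (differentiableAt_const (c • .id ℝ E)).congr_of_eventuallyEq
    (Filter.eventually_of_mem (extChartAt_target_mem_nhds p) fun _ hy ↦ chartEnd_smul_id c hy)

theorem covDerivEnd_smul_id (cov : CovariantDerivative I E (TangentSpace I : M → Type _)) (c : ℝ)
    (x y : TangentSpace I p) :
    covDerivEnd cov (fun q ↦ c • .id ℝ (TangentSpace I q)) p x y = 0 := by
  have hY := FiberBundle.mdifferentiableAt_extend I E y
  have hsmul := cov.isCovariantDerivativeOnUniv.smul_const c hY
  exact sub_eq_zero.2 (DFunLike.congr_fun hsmul x)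

variable [FiniteDimensional ℝ E]

theorem leeForm_smul_id (g : FormField I M) (c : ℝ) (z : TangentSpace I p) :
    leeForm g (fun q ↦ c • .id ℝ (TangentSpace I q)) p z = 0 := by
  simp [leeForm, structureTensor, covDerivEnd_smul_id, metricTrace_zero]

theorem leeForm_zero (g : FormField I M) (z : TangentSpace I p) : leeForm g 0 p z = 0 := by
  simpa [← Pi.zero_def] using leeForm_smul_id g 0 z

theorem leeForm_neg_id (g : FormField I M) (z : TangentSpace I p) :
    leeForm g (fun q ↦ -.id ℝ (TangentSpace I q)) p z = 0 := by
  simpa using leeForm_smul_id g (-1) z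

theorem associatedRicci_zero (g : FormField I M) (y z : TangentSpace I p) :
    associatedRicci g 0 p y z = 0 := by
  simp [associatedRicci, curvatureTensor, metricTrace_zero]

theorem associatedRicci_neg_id (g : FormField I M) (y z : TangentSpace I p) :
    associatedRicci g (fun q ↦ -.id ℝ (TangentSpace I q)) p y z = -ricci g p y z := by
  simp [associatedRicci, ricci, curvatureTensor, metricTrace_neg]

variable [I.Boundaryless] {g : FormField I M}

theorem associatedRicci_apply_zero (hg : IsPseudoRiemannian g) (A : EndField I M)
    (z : TangentSpace I p) : associatedRicci g A p 0 z = 0 := by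
  simp [associatedRicci, curvatureTensor_eq_chartMetric hg, chartCurvature, chartNabla,
    metricTrace_zero]

variable (hg : IsPseudoRiemannian g) {A : EndField I M}
  (hA : MDifferentiable I (I.prod 𝓘(ℝ, E →L[ℝ] E)) fun p ↦ TotalSpace.mk' (E →L[ℝ] E)
    (E := fun p : M ↦ TangentSpace I p →L[ℝ] TangentSpace I p) p (A p))
  (u : TangentBundle I M) (ζ : TangentSpace I.tangent u)

include hg

theorem leeForm_liftJ₂ :
    leeForm (completeLift g) (liftJ₂ g) u ζ =
      -ricci g u.proj u.snd (horizontalPart (leviCivita g) u ζ) := by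
  have hzero := differentiableAt_chartEnd_zero (I := I) u.proj (extChartAt I u.proj u.proj)
  have hid : DifferentiableAt ℝ (chartEnd (fun q ↦ .id ℝ (TangentSpace I q)) u.proj)
      (extChartAt I u.proj u.proj) := by simpa using differentiableAt_chartEnd_smul_id 1 u.proj
  have hneg : DifferentiableAt ℝ (chartEnd (fun q ↦ -.id ℝ (TangentSpace I q)) u.proj)
      (extChartAt I u.proj u.proj) := by simpa using differentiableAt_chartEnd_smul_id (-1) u.proj
  rw [liftJ₂_eq_blockLift, leeForm_blockLift hg hzero hid hneg hzero, leeForm_neg_id,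
    leeForm_zero, associatedRicci_neg_id, zero_add, zero_add]

include hA

theorem leeForm_liftJ₁ :
    leeForm (completeLift g) (liftJ₁ g A) u ζ =
      leeForm g A u.proj (horizontalPart (leviCivita g) u ζ) := by
  have hA' := differentiableAt_chartEnd hA u.proj
  have hneg : DifferentiableAt ℝ (chartEnd (-A) u.proj) (extChartAt I u.proj u.proj) :=
    chartEnd_neg A u.proj ▸ hA'.neg
  have hzero := differentiableAt_chartEnd_zero (I := I) u.proj (extChartAt I u.proj u.proj)
  rw [liftJ₁_eq_blockLift, leeForm_blockLift hg hneg hzero hzero hA', leeForm_zero,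
    associatedRicci_zero, zero_add, add_zero]

theorem leeForm_liftJ₃ :
    leeForm (completeLift g) (liftJ₃ g A) u ζ =
      leeForm g A u.proj (verticalPart (leviCivita g) u ζ) +
        associatedRicci g A u.proj u.snd (horizontalPart (leviCivita g) u ζ) := by
  have hA' := differentiableAt_chartEnd hA u.proj
  have hzero := differentiableAt_chartEnd_zero (I := I) u.proj (extChartAt I u.proj u.proj)
  rw [liftJ₃_eq_blockLift, leeForm_blockLift hg hzero hA' hA' hzero, leeForm_zero, add_zero]

end StructureLifts

end AlmostNorden

end

open AlmostNorden in
theorem mainTheorem8_general {E : Type*} [NormedAddCommGroup E] [NormedSpace ℝ E]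
    [FiniteDimensional ℝ E] {H : Type*} [TopologicalSpace H] {I : ModelWithCorners ℝ E H}
    [I.Boundaryless] {M : Type*} [TopologicalSpace M] [ChartedSpace H M] [IsManifold I ∞ M]
    {g : FormField I M} (hg : IsPseudoRiemannian g) {A : EndField I M}
    (hA : MDifferentiable I (I.prod 𝓘(ℝ, E →L[ℝ] E)) fun p ↦ TotalSpace.mk' (E →L[ℝ] E)
      (E := fun p : M ↦ TangentSpace I p →L[ℝ] TangentSpace I p) p (A p)) :
    ((∀ u ξ, leeForm (completeLift g) (liftJ₁ g A) u ξ = 0) ↔ ∀ p z, leeForm g A p z = 0) ∧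
    ((∀ u ξ, leeForm (completeLift g) (liftJ₂ g) u ξ = 0) ↔ ∀ p y z, ricci g p y z = 0) ∧
    ((∀ u ξ, leeForm (completeLift g) (liftJ₃ g A) u ξ = 0) ↔
      (∀ p z, leeForm g A p z = 0) ∧ ∀ p y z, associatedRicci g A p y z = 0) := by
  simp only [leeForm_liftJ₁ hg hA, leeForm_liftJ₂ hg, leeForm_liftJ₃ hg hA, neg_eq_zero]
  refine ⟨⟨fun h p z ↦ ?_, fun h _ _ ↦ h _ _⟩, ⟨fun h p y z ↦ ?_, fun h _ _ ↦ h _ _ _⟩,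
    fun h ↦ ?_, fun ⟨hθ, hρ⟩ _ _ ↦ by rw [hθ, hρ, add_zero]⟩
  · have hz := h ⟨p, 0⟩ (horizontalLift (leviCivita g) _ z)
    rwa [horizontalPart_horizontalLift] at hz
  · have hz := h ⟨p, y⟩ (horizontalLift (leviCivita g) _ z)
    rwa [horizontalPart_horizontalLift] at hz
  · have hθ (p : M) (z : TangentSpace I p) : leeForm g A p z = 0 := by
      have hz := h ⟨p, 0⟩ (verticalLift _ z)
      rwa [verticalPart_verticalLift, associatedRicci_apply_zero hg, add_zero] at hz
    refine ⟨hθ, fun p y z ↦ ?_⟩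
    have hz := h ⟨p, y⟩ (horizontalLift (leviCivita g) _ z)
    rwa [hθ, zero_add, horizontalPart_horizontalLift] at hz

theorem mainTheorem8 {E : Type*} [NormedAddCommGroup E] [NormedSpace ℝ E] [FiniteDimensional ℝ E]
    {M : Type*} [TopologicalSpace M] [ChartedSpace E M] [IsManifold 𝓘(ℝ, E) ∞ M]
    (S : AlmostNorden.AlmostNordenStructure 𝓘(ℝ, E) M) :
    ((∀ u ξ, AlmostNorden.leeForm (AlmostNorden.completeLift S.g)
        (AlmostNorden.liftJ₁ S.g S.J) u ξ = 0) ↔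
      ∀ p z, AlmostNorden.leeForm S.g S.J p z = 0) ∧
    ((∀ u ξ, AlmostNorden.leeForm (AlmostNorden.completeLift S.g)
        (AlmostNorden.liftJ₂ S.g) u ξ = 0) ↔
      ∀ p y z, AlmostNorden.ricci S.g p y z = 0) ∧
    ((∀ u ξ, AlmostNorden.leeForm (AlmostNorden.completeLift S.g)
        (AlmostNorden.liftJ₃ S.g S.J) u ξ = 0) ↔
      (∀ p z, AlmostNorden.leeForm S.g S.J p z = 0) ∧
        ∀ p y z, AlmostNorden.associatedRicci S.g S.J p y z = 0) :=
  mainTheorem8_general S.isPseudoRiemannian (S.J_smooth.mdifferentiable (by simp))
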